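/- Let $N\ge 1$, $m\ge 2$, and let $T_1,\dots,T_m$ be non-singular linear maps on $\mathbb R^N$ with Euclidean operator norm $\|T_i\|<1$. For a finite word $\mathbf i=(i_1,\dots,i_k)$ over $\{1,\dots,m\}$ put $T_{\mathbf i}=T_{i_1}\cdots T_{i_k}$ ($T_\emptyset=\mathrm{id}$), and let $C_{\mathbf i}\subset I_\infty=\{1,\dots,m\}^{\mathbb N}$ be the cylinder of infinite words beginning with $\mathbf i$; for distinct $\mathbf i,\mathbf j\in I_\infty$ let $\mathbf i\wedge\mathbf j$ be their longest common initial word. For a non-singular linear contraction $T$ with singular values $\alpha_1\ge\dots\ge\alpha_N>0$ let $\phi^s(T)=\alpha_1\cdots\alpha_{l-1}\alpha_l^{\,s-l+1}$ if $0<s\le N$, where $l$ is the integer with $l-1<s\le l$, and let $\phi^0(T)=1$ and $\phi^s(T)=(\alpha_1\cdots\alpha_N)^{s/N}$ for $s>N$. Let $p_1,\dots,p_m>0$ with $\sum_i p_i=1$, and let $\mu$ be the Bernoulli measure on $I_\infty$, $\mu(C_{\mathbf i})=p_{i_1}\cdots p_{i_k}$. Put $$P(s,1)=\lim_{k\to\infty}\frac1k\sum_{|\mathbf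 i|=k}\mu(C_{\mathbf i})\log\big(\phi^s(T_{\mathbf i})^{-1}\mu(C_{\mathbf i})\big).$$ Let $(\Omega,\mathbb P)$ be a probability space carrying random vectors $\omega_{\mathbf i}\in\mathbb R^N$, indexed by the finite words $\mathbf i$ and jointly measurable, and suppose that there is a non-empty compact set $B\subset\mathbb R^N$ such that, for every outcome, $T_{i_k}(B)+\omega_{i_1,\dots,i_k}\subseteq B$ for all words $(i_1,\dots,i_k)$, $k\ge1$. For $\mathbf i=(i_1,i_2,\dots)\in I_\infty$ put $$x^\omega(\mathbf i)=\omega_{i_1}+T_{i_1}\omega_{i_1,i_2}+T_{i_1}T_{i_2}\omega_{i_1,i_2,i_3}+\cdots,$$ let $E^\omega=\{x^\omega(\mathbf i):\mathbf i\in I_\infty\}$ be the almost self-affine set, and let $\mu^\omega$ be the image of $\mu$ under $\mathbf i\mapsto x^\omega(\mathbf i)$, a probability measure on $E^\omega$. Then there is a unique number $d_1>0$ for which $P(d_1,1)=0$. Suppose moreover that there are numbers $s<\min\{d_1,N\}$ arbitrarily close to $\min\{d_1,N\}$ for each of which there exists $c<\infty$ with $$\mathbb E\big(|x^\omega(\mathbf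 i)-x^\omega(\mathbf j)|^{-s}\big)\le\frac{c}{\phi^s(T_{\mathbf i\wedge\mathbf j})}\qquad\text{for all distinct }\mathbf i,\mathbf j\in I_\infty .$$ Then, for $\mathbb P$-almost all $\omega$, the measure $\mu^\omega$ is exact dimensional, with $$\lim_{r\to0}\frac{\log\mu^\omega(B(x,r))}{\log r}=D^1(\mu^\omega)=\min\{d_1,N\}\qquad\text{for }\mu^\omega\text{-almost all }x .$$ Here $B(x,r)$ is the closed ball, and $D^1(\nu)=d$ means that the limit, as $r\to0$, of $\sum_C\nu(C)\log\nu(C)/\log r$ exists and equals $d$, where $C$ runs over the mesh cubes $[j_1r,(j_1+1)r)\times\cdots\times[j_Nr,(j_N+1)r)$, $j_1,\dots,j_N\in\mathbb Z$. -/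

import Mathlib

open MeasureTheory Filter Topology
open scoped ENNReal

noncomputable section

namespace AlmostSelfAffine

/-- The first `k` letters `i|k` of an infinite word `i`. Finite words (the set `I`) are lists. -/
def curtail {m : ℕ} (i : ℕ → Fin m) (k : ℕ) : List (Fin m) :=
  List.ofFn (fun j : Fin k => i j)

/-- The cylinder `C_u` of all infinite words that begin with the finite word `u`. -/
def cyl {m : ℕ} (u : List (Fin m)) : Set (ℕ → Fin m) :=
  {i | curtail i u.length = u}

/-- The common initial word `i ∧ j` of two distinct infinite words: `PiNat.firstDiff i j` is the
first (zero-based) place at which they differ. -/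
def meet {m : ℕ} (i j : ℕ → Fin m) : List (Fin m) :=
  curtail i (PiNat.firstDiff i j)

/-- The Bernoulli measure on code space: the infinite product of the distribution `∑ pᵢ δᵢ` on the
alphabet. -/
def bernoulliMeasure {m : ℕ} (p : Fin m → ℝ) : Measure (ℕ → Fin m) :=
  Measure.infinitePi (fun _ : ℕ => ∑ a : Fin m, ENNReal.ofReal (p a) • Measure.dirac a)

/-- The Bernoulli measure of the cylinder `C_u` is `p_{u₁} p_{u₂} ⋯ p_{u_k}`. -/
theorem bernoulliMeasure_cyl {m : ℕ} (p : Fin m → ℝ) (hp : ∀ a, 0 < p a) (hp1 : ∑ a, p a = 1)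
    (u : List (Fin m)) : bernoulliMeasure p (cyl u) = ENNReal.ofReal (u.map p).prod := by
  have : IsProbabilityMeasure (∑ a : Fin m, ENNReal.ofReal (p a) • Measure.dirac a) := by
    constructor
    simp [← ENNReal.ofReal_sum_of_nonneg (fun a _ => (hp a).le), hp1]
  have hc : cyl u = Set.pi (Finset.range u.length : Set ℕ) (fun n => {b | u[n]? = some b}) := by
    ext i
    simp only [cyl, curtail, Set.mem_ofPred_eq, Set.mem_pi, Finset.coe_range, Set.mem_Iio]
    rw [List.ext_getElem_iff]
    simp
    constructor
    · intro h n hn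
      rw [List.getElem?_eq_getElem hn, h n hn]
    · intro h n hn
      have := h n hn
      rw [List.getElem?_eq_getElem hn] at this
      simpa using this.symm
  rw [hc, bernoulliMeasure, Measure.infinitePi_pi _ (fun _ _ => .of_discrete)]
  have : ∀ n (hn : n < u.length),
      (∑ a : Fin m, ENNReal.ofReal (p a) • Measure.dirac a) {b | u[n]? = some b} =
        ENNReal.ofReal (p u[n]) := by
    intro n hn
    simp [hn, Set.indicator_apply]
  rw [Finset.prod_congr rfl (g := fun n => ENNReal.ofReal ((u.map p)[n]?.getD 1))
    (by intro n hn; simp at hn; rw [this n hn]; simp [hn]), ← ENNReal.ofReal_prod_of_nonneg]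
  · congr 1
    rw [Finset.prod_range]
    simp [← List.prod_ofFn]
  · intro n hn
    simp at hn
    simp [hn, (hp _).le]

/-- `T_u = T_{u₁} T_{u₂} ⋯ T_{u_k}` for a finite word `u` (the identity for the empty word). -/
def wordMap {m N : ℕ} (T : Fin m → EuclideanSpace ℝ (Fin N) →L[ℝ] EuclideanSpace ℝ (Fin N))
    (u : List (Fin m)) : EuclideanSpace ℝ (Fin N) →L[ℝ] EuclideanSpace ℝ (Fin N) :=
  (u.map T).prod

/-- The singular value function `φ^s(T)`, `s ≥ 0`. Write `α₁ ≥ ⋯ ≥ α_N` for the singular values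
(`singularValues j` is `α_{j+1}`). For `s ≤ N` it is `α₁ ⋯ α_n α_{n+1}^{s-n}` with `n = ⌊s⌋`; for
positive `s` this is the same number as `α₁ ⋯ α_{l-1} α_l^{s-l+1}` with `l - 1 < s ≤ l`, and for
`s = 0` it is `1`. For `s > N` it is `(α₁ ⋯ α_N)^{s/N}`. -/
def svf {N : ℕ} (s : ℝ) (T : EuclideanSpace ℝ (Fin N) →L[ℝ] EuclideanSpace ℝ (Fin N)) : ℝ :=
  if s ≤ N then
    (∏ j ∈ Finset.range ⌊s⌋₊, T.toLinearMap.singularValues j) *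
      T.toLinearMap.singularValues ⌊s⌋₊ ^ (s - (⌊s⌋₊ : ℝ))
  else
    (∏ j ∈ Finset.range N, T.toLinearMap.singularValues j) ^ (s / (N : ℝ))

/-- `HasPressureOne T μ s L` says that the limit defining the pressure `P(s,1)` exists and
equals `L`:
`(1/k) ∑_{|u|=k} μ(C_u) log (φ^s(T_u)⁻¹ μ(C_u)) → L` as `k → ∞`. -/
def HasPressureOne {m N : ℕ}
    (T : Fin m → EuclideanSpace ℝ (Fin N) →L[ℝ] EuclideanSpace ℝ (Fin N))
    (μ : Measure (ℕ → Fin m)) (s L : ℝ) : Prop :=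
  Tendsto (fun k : ℕ => (1 / (k : ℝ)) * ∑ u : Fin k → Fin m,
      μ.real (cyl (List.ofFn u)) *
        Real.log ((svf s (wordMap T (List.ofFn u)))⁻¹ * μ.real (cyl (List.ofFn u))))
    atTop (𝓝 L)

/-- The point `x^w(i) = w_{i₁} + T_{i₁} w_{i₁i₂} + T_{i₁} T_{i₂} w_{i₁i₂i₃} + ⋯`, for a family `w`
of translation vectors indexed by the finite words (the value at the empty word is not used). -/
def point {m N : ℕ} (T : Fin m → EuclideanSpace ℝ (Fin N) →L[ℝ] EuclideanSpace ℝ (Fin N))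
    (w : List (Fin m) → EuclideanSpace ℝ (Fin N)) (i : ℕ → Fin m) : EuclideanSpace ℝ (Fin N) :=
  ∑' k : ℕ, wordMap T (curtail i k) (w (curtail i (k + 1)))

/-- The projection `μ^w` of a measure `μ` on code space: its image under `i ↦ x^w(i)`. -/
def projMeasure {m N : ℕ} (T : Fin m → EuclideanSpace ℝ (Fin N) →L[ℝ] EuclideanSpace ℝ (Fin N))
    (μ : Measure (ℕ → Fin m)) (w : List (Fin m) → EuclideanSpace ℝ (Fin N)) :
    Measure (EuclideanSpace ℝ (Fin N)) :=
  μ.map (point T w)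

/-- `ν` is exact of dimension `d`: the local dimension of `ν` exists and equals `d` at `ν`-almost
every point. -/
def IsExactOfDimension {N : ℕ} (ν : Measure (EuclideanSpace ℝ (Fin N))) (d : ℝ) : Prop :=
  ∀ᵐ x ∂ν, Tendsto (fun r : ℝ => Real.log (ν.real (Metric.closedBall x r)) / Real.log r)
    (𝓝[>] 0) (𝓝 d)

/-- The `r`-mesh cube `[j₁ r, (j₁+1) r) × ⋯ × [j_N r, (j_N+1) r)`. -/
def meshCube {N : ℕ} (r : ℝ) (j : Fin N → ℤ) : Set (EuclideanSpace ℝ (Fin N)) :=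
  {x | ∀ l, x l ∈ Set.Ico ((j l : ℝ) * r) (((j l : ℝ) + 1) * r)}

/-- `-∑ ν(C) log ν(C)` over the `r`-mesh cubes `C`, as a sum of nonnegative terms in `[0,∞]`
(`ν` is a probability measure). -/
def meshEntropy {N : ℕ} (ν : Measure (EuclideanSpace ℝ (Fin N))) (r : ℝ) : ℝ≥0∞ :=
  ∑' j : Fin N → ℤ, ENNReal.ofReal (-(ν.real (meshCube r j) * Real.log (ν.real (meshCube r j))))

/-- The lower information dimension, the lower limit of `∑ ν(C) log ν(C) / log r` as `r → 0`; the
signs of numerator and denominator are both reversed. -/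
def lowerInfoDim {N : ℕ} (ν : Measure (EuclideanSpace ℝ (Fin N))) : ℝ≥0∞ :=
  liminf (fun r : ℝ => meshEntropy ν r / ENNReal.ofReal (-Real.log r)) (𝓝[>] 0)

/-- The upper information dimension, the upper limit of the same quotient. -/
def upperInfoDim {N : ℕ} (ν : Measure (EuclideanSpace ℝ (Fin N))) : ℝ≥0∞ :=
  limsup (fun r : ℝ => meshEntropy ν r / ENNReal.ofReal (-Real.log r)) (𝓝[>] 0)

/-- `D¹(ν) = d`: the lower and the upper information dimension both equal `d`. -/
def HasInfoDim {N : ℕ} (ν : Measure (EuclideanSpace ℝ (Fin N))) (d : ℝ) : Prop :=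
  lowerInfoDim ν = ENNReal.ofReal d ∧ upperInfoDim ν = ENNReal.ofReal d

end AlmostSelfAffine

end

open AlmostSelfAffine

/-! For a finite word u put ψ_s(u) = log φ^s(T_u) - log μ(C_u) (`wordCocycle`). Since φ^s is
submultiplicative and μ is multiplicative on cylinders, ψ_s is a subadditive cocycle over the
Bernoulli shift, and the subadditive ergodic theorem gives ψ_s(i|k)/k → -P(s,1) for almost every i.
The function P(·,1) is bi-Lipschitz and strictly increasing on [0,∞), and P(0,1) is minus the
entropy of μ, hence negative; so there is exactly one positive zero d₁.

Lower bound. If s < d₁, then P(s,1) < 0 and μ(C_{i|k})/φ^s(T_{i|k}) decays geometrically for almost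
every i. Sorting the words j by i∧j, the assumed estimate bounds the expected s-potential of μ^ω at
x^ω(i) by a constant times the sum of these quotients (`ae_tsum_cyl_ne_top`). By Tonelli
(`ae_ae_lintegral_lt_top`) the potential is finite at μ^ω-almost every point for almost every ω, and
so balls of radius r have mass O(r^s).

Upper bound, valid for every ω. Let d₁ < s < N. The image of C_u lies in a translated copy of
T_u(ball), which is covered by O(φ^s(T_u) r^{-s}) cubes of side r, the singular value of T_u with
zero-based index ⌊s⌋ (`exists_cells`). By Borel–Cantelli a typical point of C_u lies in a cube of
mass at least e^{-εk} times the average, that is about e^{-εk} e^{-ψ_s(u)} r^s. Since P(s,1) > 0,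
the factor e^{-ψ_s(u)} grows exponentially and beats e^{-εk}. The scales r have bounded ratios as
the word grows, so all small radii are reached. If d₁ ≥ N, the bound N holds for any probability
measure on ℝ^N, by differentiation of Lebesgue measure.

The two power bounds on ball masses give exact dimensionality directly, and the information
dimension by comparing mesh cubes with balls (`hasInfoDim_of_bounds`). -/

/-! ### Singular values: min-max bounds and submultiplicativity -/

namespace LinearMap

open Module InnerProductSpace

variable {U F : Type*} [NormedAddCommGroup U] [InnerProductSpace ℝ U] [FiniteDimensional ℝ U]
  [NormedAddCommGroup F] [InnerProductSpace ℝ F] [FiniteDimensional ℝ F]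

/-- An orthonormal basis of right singular vectors, in decreasing order of the singular values. -/
noncomputable def rightSingularBasis (T : U →ₗ[ℝ] F) {n : ℕ} (hn : finrank ℝ U = n) :
    OrthonormalBasis (Fin n) ℝ U :=
  T.isSymmetric_adjoint_comp_self.eigenvectorBasis hn

theorem inner_map_rightSingularBasis (T : U →ₗ[ℝ] F) {n : ℕ} (hn : finrank ℝ U = n) (x : U)
    (i : Fin n) : inner ℝ (T x) (T (T.rightSingularBasis hn i)) =
      T.singularValues i ^ 2 * inner ℝ x (T.rightSingularBasis hn i) := by
  rw [← LinearMap.adjoint_inner_right, ← LinearMap.comp_apply, rightSingularBasis,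
    T.isSymmetric_adjoint_comp_self.apply_eigenvectorBasis hn i, T.sq_singularValues_fin hn]
  simp [inner_smul_right]

theorem sq_norm_map_eq_sum (T : U →ₗ[ℝ] F) {n : ℕ} (hn : finrank ℝ U = n) (x : U) :
    ‖T x‖ ^ 2 =
      ∑ i : Fin n, T.singularValues i ^ 2 * inner ℝ x (T.rightSingularBasis hn i) ^ 2 := by
  rw [← real_inner_self_eq_norm_sq]
  nth_rewrite 2 [← (T.rightSingularBasis hn).sum_repr' x]
  simp only [map_sum, map_smul, inner_sum, inner_smul_right, inner_map_rightSingularBasis]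
  refine Finset.sum_congr rfl fun i _ => ?_
  rw [real_inner_comm]
  ring

theorem sq_norm_eq_sum_rightSingularBasis (T : U →ₗ[ℝ] F) {n : ℕ} (hn : finrank ℝ U = n) (x : U) :
    ‖x‖ ^ 2 = ∑ i : Fin n, inner ℝ x (T.rightSingularBasis hn i) ^ 2 := by
  rw [← (T.rightSingularBasis hn).sum_sq_norm_inner_left x]
  simp

theorem singularValues_mul_norm_le (T : U →ₗ[ℝ] F) {n : ℕ} (hn : finrank ℝ U = n) (i : ℕ) (x : U)
    (hx : ∀ j : Fin n, i < j → inner ℝ x (T.rightSingularBasis hn j) = 0) :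
    T.singularValues i * ‖x‖ ≤ ‖T x‖ := by
  refine le_of_sq_le_sq ?_ (norm_nonneg _)
  rw [mul_pow, sq_norm_map_eq_sum T hn, sq_norm_eq_sum_rightSingularBasis T hn x, Finset.mul_sum]
  refine Finset.sum_le_sum fun j _ => ?_
  rcases lt_or_ge i j with h | h
  · simp [hx j h]
  · have := T.singularValues_antitone h
    have := T.singularValues_nonneg i
    gcongr

theorem norm_le_singularValues_mul (T : U →ₗ[ℝ] F) {n : ℕ} (hn : finrank ℝ U = n) (i : ℕ) (x : U)
    (hx : ∀ j : Fin n, (j : ℕ) < i → inner ℝ x (T.rightSingularBasis hn j) = 0) :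
    ‖T x‖ ≤ T.singularValues i * ‖x‖ := by
  have h0 := T.singularValues_nonneg i
  refine le_of_sq_le_sq ?_ (by positivity)
  rw [mul_pow, sq_norm_map_eq_sum T hn, sq_norm_eq_sum_rightSingularBasis T hn x, Finset.mul_sum]
  refine Finset.sum_le_sum fun j _ => ?_
  rcases lt_or_ge (j : ℕ) i with h | h
  · simp [hx j h]
  · have := T.singularValues_antitone h
    have := T.singularValues_nonneg j
    gcongr

/-- A lower bound for `T` on a subspace of dimension larger than `i` bounds the singular value of
index `i` from below. -/
theorem le_singularValues_of_subspace (T : U →ₗ[ℝ] F) (V : Submodule ℝ U) {i : ℕ}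
    (hi : i < finrank ℝ V) {c : ℝ} (hV : ∀ x ∈ V, c * ‖x‖ ≤ ‖T x‖) : c ≤ T.singularValues i := by
  let e := T.rightSingularBasis rfl
  have hiU : i ≤ finrank ℝ U := hi.le.trans V.finrank_le
  -- A subspace of dimension larger than i contains a nonzero vector orthogonal to the first i right
  -- singular vectors, and T stretches such a vector by at most the singular value of index i.
  let f : V →ₗ[ℝ] (Fin i → ℝ) :=
    LinearMap.pi fun j => (innerₗ U (e (Fin.castLE hiU j))) ∘ₗ V.subtype
  have hf : f.ker ≠ ⊥ := f.ker_ne_bot_of_finrank_lt (by simpa using hi)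
  obtain ⟨x, hx, hx0⟩ := (Submodule.ne_bot_iff _).1 hf
  have hxj : ∀ j : Fin (finrank ℝ U), (j : ℕ) < i → inner ℝ (x : U) (e j) = 0 := by
    intro j hj
    have := congrFun (LinearMap.mem_ker.1 hx) ⟨j, hj⟩
    simpa [f, real_inner_comm] using this
  have h1 := (hV x x.2).trans (T.norm_le_singularValues_mul rfl i x hxj)
  have : 0 < ‖(x : U)‖ := by simpa using hx0
  exact le_of_mul_le_mul_right h1 this

/-- The span of the first `n` right singular vectors. -/
theorem exists_subspace_singularValues (T : U →ₗ[ℝ] F) {n : ℕ} (hn : n ≤ finrank ℝ U) :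
    ∃ V : Submodule ℝ U, finrank ℝ V = n ∧ ∀ i < n, ∃ W ≤ V, finrank ℝ W = i + 1 ∧
      ∀ x ∈ W, T.singularValues i * ‖x‖ ≤ ‖T x‖ := by
  let e := T.rightSingularBasis rfl
  let W (k : ℕ) (hk : k ≤ finrank ℝ U) : Submodule ℝ U :=
    Submodule.span ℝ (Set.range fun j : Fin k => e (Fin.castLE hk j))
  have hW : ∀ k hk, finrank ℝ (W k hk) = k := by
    intro k hk
    have := finrank_span_eq_card (R := ℝ)
      (e.orthonormal.linearIndependent.comp _ (Fin.castLE_injective hk))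
    rwa [Fintype.card_fin] at this
  refine ⟨W n hn, hW n hn, fun i hi => ⟨W (i + 1) (by omega), ?_, hW _ _, fun x hx => ?_⟩⟩
  · refine Submodule.span_mono ?_
    rintro _ ⟨j, rfl⟩
    exact ⟨Fin.castLE hi j, rfl⟩
  · refine T.singularValues_mul_norm_le rfl i x fun j hj => ?_
    have : W (i + 1) (by omega) ≤ (ℝ ∙ e j)ᗮ := by
      rw [Submodule.span_le]
      rintro _ ⟨l, rfl⟩
      rw [SetLike.mem_coe, Submodule.mem_orthogonal_singleton_iff_inner_right]
      refine e.orthonormal.2 ?_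
      intro h
      have := congrArg Fin.val h
      simp at this
      omega
    exact (Submodule.mem_orthogonal_singleton_iff_inner_left).1 (this hx)

theorem exists_subspace_singularValue (T : U →ₗ[ℝ] F) {i : ℕ} (hi : i < finrank ℝ U) :
    ∃ W : Submodule ℝ U, finrank ℝ W = i + 1 ∧ ∀ x ∈ W, T.singularValues i * ‖x‖ ≤ ‖T x‖ := by
  obtain ⟨V, -, h⟩ := T.exists_subspace_singularValues (Nat.succ_le_of_lt hi)
  obtain ⟨W, -, h⟩ := h i (Nat.lt_succ_self i)
  exact ⟨W, h⟩

theorem singularValues_domRestrict_le (T : U →ₗ[ℝ] F) (V : Submodule ℝ U) (i : ℕ) :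
    (T.domRestrict V).singularValues i ≤ T.singularValues i := by
  rcases lt_or_ge i (finrank ℝ V) with hi | hi
  · obtain ⟨W, hW, h⟩ := (T.domRestrict V).exists_subspace_singularValue hi
    refine T.le_singularValues_of_subspace (W.map V.subtype) ?_ ?_
    · rw [Submodule.finrank_map_subtype_eq, hW]
      exact Nat.lt_succ_self i
    · rintro _ ⟨x, hx, rfl⟩
      simpa using h x hx
  · rw [singularValues_of_finrank_le _ hi]
    exact T.singularValues_nonneg i

/-- With the next lemma this characterizes the product of the first n singular values as the largest
n-dimensional volume distortion of T. Volume distortion is multiplicative under composition, whence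
the submultiplicativity below. -/
theorem normDet_domRestrict_le (T : U →ₗ[ℝ] F) (V : Submodule ℝ U) :
    (T.domRestrict V).normDet ≤ ∏ i ∈ Finset.range (finrank ℝ V), T.singularValues i := by
  rw [normDet_eq_prod_singularValues]
  exact Finset.prod_le_prod (fun i _ => singularValues_nonneg _ i)
    fun i _ => T.singularValues_domRestrict_le V i

theorem exists_prod_singularValues_le_normDet (T : U →ₗ[ℝ] F) {n : ℕ} (hn : n ≤ finrank ℝ U) :
    ∃ V : Submodule ℝ U, finrank ℝ V = n ∧
      ∏ i ∈ Finset.range n, T.singularValues i ≤ (T.domRestrict V).normDet := by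
  obtain ⟨V, hV, h⟩ := T.exists_subspace_singularValues hn
  refine ⟨V, hV, ?_⟩
  rw [normDet_eq_prod_singularValues, hV]
  refine Finset.prod_le_prod (fun i _ => singularValues_nonneg _ i) fun i hi => ?_
  obtain ⟨W, hWV, hW, hx⟩ := h i (Finset.mem_range.1 hi)
  refine le_singularValues_of_subspace _ (W.comap V.subtype) ?_ fun x hx' => ?_
  · rw [(Submodule.comapSubtypeEquivOfLe hWV).finrank_eq, hW]
    exact Nat.lt_succ_self i
  · simpa using hx x hx'

/-- The product of the first `n` singular values is submultiplicative. -/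
theorem prod_singularValues_comp_le {G : Type*} [NormedAddCommGroup G] [InnerProductSpace ℝ G]
    [FiniteDimensional ℝ G] (S : F →ₗ[ℝ] G) (T : U →ₗ[ℝ] F) (hT : Function.Injective T) {n : ℕ}
    (hn : n ≤ finrank ℝ U) :
    ∏ i ∈ Finset.range n, (S ∘ₗ T).singularValues i ≤
      (∏ i ∈ Finset.range n, S.singularValues i) * ∏ i ∈ Finset.range n, T.singularValues i := by
  obtain ⟨V, hV, h⟩ := (S ∘ₗ T).exists_prod_singularValues_le_normDet hn
  refine h.trans ?_
  have h1 : (S ∘ₗ T).domRestrict V = S ∘ₗ (T.domRestrict V) := rfl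
  -- By injectivity the image of V still has dimension n, so that exactly n singular values of S
  -- enter.
  have hr : finrank ℝ (T.domRestrict V).range = n := by
    rw [finrank_range_of_inj, hV]
    exact hT.comp Subtype.val_injective
  rw [h1, normDet_comp]
  have h2 := S.normDet_domRestrict_le (T.domRestrict V).range
  have h3 := T.normDet_domRestrict_le V
  rw [hr] at h2
  rw [hV] at h3
  exact mul_le_mul h2 h3 (normDet_nonneg _)
    (Finset.prod_nonneg fun i _ => singularValues_nonneg _ i)

theorem singularValues_le_of_norm_le (T : U →ₗ[ℝ] F) {c : ℝ} (hc : 0 ≤ c)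
    (h : ∀ x, ‖T x‖ ≤ c * ‖x‖) (i : ℕ) : T.singularValues i ≤ c := by
  rcases lt_or_ge i (finrank ℝ U) with hi | hi
  · obtain ⟨W, hW, hx⟩ := T.exists_subspace_singularValue hi
    have : W ≠ ⊥ := by
      rintro rfl
      simp at hW
    obtain ⟨x, hxW, hx0⟩ := (Submodule.ne_bot_iff _).1 this
    exact le_of_mul_le_mul_right ((hx x hxW).trans (h x)) (norm_pos_iff.2 hx0)
  · rwa [singularValues_of_finrank_le _ hi]

theorem le_singularValues_of_le_norm (T : U →ₗ[ℝ] F) {c : ℝ}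
    (h : ∀ x, c * ‖x‖ ≤ ‖T x‖) {i : ℕ} (hi : i < finrank ℝ U) : c ≤ T.singularValues i :=
  T.le_singularValues_of_subspace ⊤ (by simpa using hi) fun x _ => h x

/-- Composing on the right with a map that is bounded below by `c` decreases singular values at
most by the factor `c`. -/
theorem mul_singularValues_le_comp (S : U →ₗ[ℝ] F) (T : U →ₗ[ℝ] U) {c : ℝ} (hc : 0 < c)
    (h : ∀ x, c * ‖x‖ ≤ ‖T x‖) (i : ℕ) :
    c * S.singularValues i ≤ (S ∘ₗ T).singularValues i := by
  rcases lt_or_ge i (finrank ℝ U) with hi | hi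
  · obtain ⟨W, hW, hx⟩ := S.exists_subspace_singularValue hi
    have hinj : Function.Injective T := by
      rw [injective_iff_map_eq_zero]
      intro x hx
      have := h x
      rw [hx, norm_zero] at this
      by_contra h0
      have := mul_pos hc (norm_pos_iff.2 h0)
      linarith
    let e := LinearEquiv.ofInjectiveEndo T hinj
    -- The test subspace for the composition is the preimage under T of the one for S; T is
    -- bijective, so the dimension is kept.
    refine le_singularValues_of_subspace _ (W.comap (e : U →ₗ[ℝ] U)) ?_ fun x hx' => ?_
    · rw [Submodule.comap_equiv_eq_map_symm, LinearEquiv.finrank_map_eq, hW]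
      exact Nat.lt_succ_self i
    · have h1 := hx (T x) hx'
      have h2 := mul_le_mul_of_nonneg_left (h x) (S.singularValues_nonneg i)
      simp only [comp_apply]
      linarith
  · rw [singularValues_of_finrank_le _ hi, singularValues_of_finrank_le _ hi, mul_zero]

/-- An orthonormal basis of left singular vectors of an injective endomorphism. -/
theorem exists_orthonormalBasis_abs_inner_le (T : U →ₗ[ℝ] U) (hT : Function.Injective T) {n : ℕ}
    (hn : finrank ℝ U = n) : ∃ f : OrthonormalBasis (Fin n) ℝ U,
      ∀ x j, |inner ℝ (T x) (f j)| ≤ T.singularValues j * ‖x‖ := by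
  let e := T.rightSingularBasis hn
  have hpos : ∀ j : Fin n, 0 < T.singularValues j := fun j =>
    T.injective_iff_forall_lt_finrank_singularValues_pos.1 hT j (hn ▸ j.2)
  -- The images of the right singular vectors are pairwise orthogonal with the singular values as
  -- lengths; normalized they are the axes of the ellipsoid T(ball).
  let v : Fin n → U := fun j => (T.singularValues j)⁻¹ • T (e j)
  have hv : Orthonormal ℝ v := by
    rw [orthonormal_iff_ite]
    intro i j
    simp only [v, inner_smul_left, inner_smul_right, e, inner_map_rightSingularBasis,
      orthonormal_iff_ite.1 (T.rightSingularBasis hn).orthonormal i j]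
    have := (hpos i).ne'
    split_ifs with h
    · subst h
      simp
      field_simp
    · simp
  have hsp : ⊤ ≤ Submodule.span ℝ (Set.range v) := by
    rw [hv.linearIndependent.span_eq_top_of_card_eq_finrank' (by simp [hn])]
  refine ⟨OrthonormalBasis.mk hv hsp, fun x j => ?_⟩
  have h1 : inner ℝ (T x) (v j) = T.singularValues j * inner ℝ x (e j) := by
    simp only [v, inner_smul_right, e, inner_map_rightSingularBasis]
    have := (hpos j).ne'
    field_simp
  rw [OrthonormalBasis.coe_mk, h1, abs_mul, abs_of_pos (hpos j)]
  have := (hpos j).le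
  gcongr
  have := abs_real_inner_le_norm x (e j)
  rwa [e.norm_eq_one, mul_one] at this

end LinearMap

/-! ### Subadditive ergodic theorem for bounded cocycles -/

section SubadditiveErgodic

variable {X : Type*} {σ : X → X} {g : ℕ → X → ℝ} {C : ℝ}

theorem mul_le_birkhoffSum {h : X → ℝ} {c : ℝ} (hc : ∀ x, c ≤ h x) (n : ℕ) (x : X) :
    c * n ≤ birkhoffSum σ h n x := by
  rw [birkhoffSum]
  calc c * n = ∑ _k ∈ Finset.range n, c := by simp [mul_comm]
    _ ≤ _ := Finset.sum_le_sum fun k _ => hc _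

/-- The greedy tiling of an orbit by blocks on which `g` is small. -/
theorem subadditive_le_birkhoffSum (hC : 0 ≤ C) (hgb : ∀ k x, |g k x| ≤ C * k)
    (hsub : ∀ k l x, g (k + l) x ≤ g k x + g l (σ^[k] x)) {c : ℝ} {M : ℕ} {S : Set X}
    (hS : ∀ x ∉ S, ∃ l, 1 ≤ l ∧ l ≤ M ∧ g l x ≤ c * l) (n : ℕ) (x : X) :
    g n x ≤ birkhoffSum σ (fun x => c + S.indicator (fun _ => C + |c|) x) n x + (C + |c|) * M := by
  have hK : 0 ≤ C + |c| := by positivity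
  have hh : ∀ x, c ≤ c + S.indicator (fun _ => C + |c|) x := fun x => by
    have := Set.indicator_nonneg (s := S) (f := fun _ => C + |c|) (fun _ _ => hK) x
    linarith
  induction n using Nat.strong_induction_on generalizing x with
  | _ n ih =>
  rcases Nat.eq_zero_or_pos n with rfl | hn
  · have := (abs_le.1 (hgb 0 x)).2
    simp only [Nat.cast_zero, mul_zero] at this
    rw [birkhoffSum_zero]
    have : 0 ≤ (C + |c|) * M := by positivity
    linarith
  -- At a point of S the orbit advances by one step, which costs at most C; the indicator term pays
  -- for it.
  by_cases hx : x ∈ S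
  · obtain ⟨m, rfl⟩ := Nat.exists_eq_add_of_le' hn
    have h1 := hsub 1 m x
    rw [add_comm 1 m] at h1
    have h2 := ih m (by omega) (σ x)
    have h3 := (abs_le.1 (hgb 1 x)).2
    rw [birkhoffSum_succ', Set.indicator_of_mem hx]
    simp only [Function.iterate_one, Nat.cast_one, mul_one] at h1 h3
    have := neg_abs_le c
    linarith
  · obtain ⟨l, hl1, hlM, hl⟩ := hS x hx
    rcases le_or_gt l n with hln | hln
    · obtain ⟨r, rfl⟩ := Nat.exists_eq_add_of_le hln
      have h1 := hsub l r x
      have h2 := ih r (by omega) (σ^[l] x)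
      have h3 := mul_le_birkhoffSum (σ := σ) hh l x
      rw [birkhoffSum_add]
      linarith
    -- A block that overshoots the end leaves n < l ≤ M steps, covered by the additive constant.
    · have h1 := (abs_le.1 (hgb n x)).2
      have h3 := mul_le_birkhoffSum (σ := σ) hh n x
      have h4 : (C + |c|) * n ≤ (C + |c|) * M := by gcongr; omega
      have h5 : -c * n ≤ |c| * n := by gcongr; exact neg_le_abs c
      linarith

theorem subadditive_mul_le_birkhoffSum (hgb : ∀ k x, |g k x| ≤ C * k)
    (hsub : ∀ k l x, g (k + l) x ≤ g k x + g l (σ^[k] x)) (n q : ℕ) (x : X) :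
    g (q * n) x ≤ birkhoffSum (σ^[n]) (g n) q x := by
  induction q generalizing x with
  | zero =>
    have := (abs_le.1 (hgb 0 x)).2
    simpa using this
  | succ q ih =>
    rw [birkhoffSum_succ', Nat.succ_mul, add_comm]
    have := hsub n (q * n) x
    linarith [ih (σ^[n] x)]

variable [MeasurableSpace X] {μ : Measure X}

theorem integral_birkhoffSum (hσ : MeasurePreserving σ μ μ) {h : X → ℝ} (hm : Measurable h)
    (hi : Integrable h μ) (n : ℕ) :
    ∫ x, birkhoffSum σ h n x ∂μ = n * ∫ x, h x ∂μ := by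
  have key : ∀ k, MeasurePreserving (σ^[k]) μ μ := fun k => hσ.iterate k
  simp only [birkhoffSum]
  rw [integral_finsetSum (f := fun k x => h (σ^[k] x)) _ fun k _ =>
    ((key k).integrable_comp hm.aestronglyMeasurable).2 hi]
  have : ∀ k, ∫ x, h (σ^[k] x) ∂μ = ∫ x, h x ∂μ := fun k => by
    have := integral_map (μ := μ) (key k).aemeasurable (f := h) (by
      rw [(key k).map_eq]; exact hm.aestronglyMeasurable)
    rw [← this, (key k).map_eq]
  simp [this]

theorem integrable_birkhoffSum (hσ : MeasurePreserving σ μ μ) {h : X → ℝ} (hm : Measurable h)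
    (hi : Integrable h μ) (n : ℕ) : Integrable (birkhoffSum σ h n) μ :=
  integrable_finsetSum _ fun k _ =>
    ((hσ.iterate k).integrable_comp hm.aestronglyMeasurable).2 hi

theorem integrable_of_abs_le [IsFiniteMeasure μ] {h : X → ℝ} (hm : Measurable h) {D : ℝ}
    (hD : ∀ x, |h x| ≤ D) : Integrable h μ :=
  Integrable.of_bound hm.aestronglyMeasurable D (Eventually.of_forall hD)

variable [IsProbabilityMeasure μ]

/-- The points without a good block of length at most M form sets decreasing to a null set. The
tiling estimate is integrated and divided by n; then n → ∞ and afterwards M → ∞. -/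
theorem le_of_forall_exists_small_block (hσ : MeasurePreserving σ μ μ) (hC : 0 ≤ C)
    (hgm : ∀ k, Measurable (g k)) (hgb : ∀ k x, |g k x| ≤ C * k)
    (hsub : ∀ k l x, g (k + l) x ≤ g k x + g l (σ^[k] x)) {L : ℝ}
    (hlim : Tendsto (fun k : ℕ => (∫ x, g k x ∂μ) / k) atTop (𝓝 L)) {c : ℝ}
    (hc : ∀ᵐ x ∂μ, ∃ l, 1 ≤ l ∧ g l x ≤ c * l) : L ≤ c := by
  have hK : 0 ≤ C + |c| := by positivity
  let S (M : ℕ) : Set X := ⋂ l ∈ Finset.Icc 1 M, {x | c * l < g l x}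
  have hSm : ∀ M, MeasurableSet (S M) := fun M =>
    Finset.measurableSet_biInter _ fun l _ => measurableSet_lt measurable_const (hgm l)
  have hS0 : Tendsto (fun M => μ.real (S M)) atTop (𝓝 0) := by
    have h1 : μ (⋂ M, S M) = 0 := by
      refine measure_mono_null (fun x hx => ?_) hc
      simp only [S, Set.mem_iInter, Finset.mem_Icc, Set.mem_ofPred_eq, Set.mem_compl_iff,
        not_exists, not_and] at hx ⊢
      intro l hl
      exact not_le.2 (hx l l ⟨hl, le_rfl⟩)
    have h2 := tendsto_measure_iInter_atTop (μ := μ) (s := S)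
      (fun M => (hSm M).nullMeasurableSet) (fun a b hab => by
        refine Set.biInter_subset_biInter_left fun l hl => ?_
        simp only [Finset.coe_Icc, Set.mem_Icc] at hl ⊢
        omega) ⟨0, measure_ne_top _ _⟩
    rw [h1] at h2
    simpa [Measure.real, Function.comp_def] using
      (ENNReal.tendsto_toReal ENNReal.zero_ne_top).comp h2
  have key : ∀ M, L ≤ c + (C + |c|) * μ.real (S M) := by
    intro M
    let h : X → ℝ := fun x => c + (S M).indicator (fun _ => C + |c|) x
    have hhm : Measurable h := measurable_const.add (measurable_const.indicator (hSm M))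
    have hhi : Integrable h μ := (integrable_const c).add
      ((integrable_const _).indicator (hSm M))
    have hint : ∫ x, h x ∂μ = c + (C + |c|) * μ.real (S M) := by
      simp only [h]
      rw [integral_add (integrable_const _) ((integrable_const _).indicator (hSm M)),
        integral_indicator_const _ (hSm M)]
      simp [mul_comm]
    have h1 : ∀ n, ∫ x, g n x ∂μ ≤ n * (c + (C + |c|) * μ.real (S M)) + (C + |c|) * M := by
      intro n
      rw [← hint, ← integral_birkhoffSum hσ hhm hhi n]
      have : ∫ x, birkhoffSum σ h n x ∂μ + (C + |c|) * M =
          ∫ x, (birkhoffSum σ h n x + (C + |c|) * M) ∂μ := by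
        rw [integral_add (integrable_birkhoffSum hσ hhm hhi n) (integrable_const _)]
        simp
      rw [this]
      refine integral_mono (integrable_of_abs_le (hgm n) (hgb n))
        ((integrable_birkhoffSum hσ hhm hhi n).add (integrable_const _)) fun x => ?_
      refine subadditive_le_birkhoffSum hC hgb hsub (fun x hx => ?_) n x
      simp only [S, Set.mem_iInter, Finset.mem_Icc, Set.mem_ofPred_eq, not_forall, not_lt] at hx
      obtain ⟨l, hl, h⟩ := hx
      exact ⟨l, hl.1, hl.2, h⟩
    have h2 : Tendsto (fun n : ℕ => (c + (C + |c|) * μ.real (S M)) + (C + |c|) * M / n) atTop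
        (𝓝 (c + (C + |c|) * μ.real (S M) + 0)) :=
      tendsto_const_nhds.add (tendsto_const_div_atTop_nhds_zero_nat _)
    rw [add_zero] at h2
    refine le_of_tendsto_of_tendsto hlim h2 ?_
    filter_upwards [eventually_gt_atTop 0] with n hn
    have hn' : (0 : ℝ) < n := by exact_mod_cast hn
    rw [div_le_iff₀ hn', add_mul, div_mul_cancel₀ _ hn'.ne']
    linarith [h1 n]
  have h3 := (hS0.const_mul (C + |c|)).const_add c
  rw [mul_zero, add_zero] at h3
  exact ge_of_tendsto h3 (Eventually.of_forall key)

/-- The lower half of the subadditive ergodic theorem, for bounded cocycles. -/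
theorem ae_eventually_lt_of_subadditive (hσ : Ergodic σ μ) (hC : 0 ≤ C)
    (hgm : ∀ k, Measurable (g k)) (hgb : ∀ k x, |g k x| ≤ C * k)
    (hsub : ∀ k l x, g (k + l) x ≤ g k x + g l (σ^[k] x)) {L : ℝ}
    (hlim : Tendsto (fun k : ℕ => (∫ x, g k x ∂μ) / k) atTop (𝓝 L)) {c : ℝ} (hc : c < L) :
    ∀ᵐ x ∂μ, ∀ᶠ k : ℕ in atTop, c * k < g k x := by
  obtain ⟨d, hcd, hdL⟩ := exists_between hc
  -- Rational q make A a countable union, hence measurable. The strict inequality q < d leaves room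
  -- to enlarge q, which absorbs the bounded cost of one extra step and yields σ⁻¹A ⊆ A. By
  -- ergodicity A is null or of full measure, and full measure would force L ≤ d.
  let A : Set X := {x | ∃ q : ℚ, (q : ℝ) < d ∧ ∃ᶠ n : ℕ in atTop, g n x ≤ q * n}
  have hAm : MeasurableSet A := by
    have : A = ⋃ q : ℚ, ⋃ _ : (q : ℝ) < d, ⋂ n : ℕ, ⋃ m : ℕ, ⋃ _ : n ≤ m, {x | g m x ≤ q * m} := by
      ext x
      simp [A, frequently_atTop]
    rw [this]
    refine .iUnion fun q => .iUnion fun _ => .iInter fun n => .iUnion fun m => .iUnion fun _ => ?_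
    exact measurableSet_le (hgm m) measurable_const
  have hinv : σ ⁻¹' A ⊆ A := by
    rintro x ⟨q, hq, hx⟩
    obtain ⟨q', hqq', hq'⟩ := exists_rat_btwn hq
    refine ⟨q', hq', ?_⟩
    have hpos : (0 : ℝ) < q' - q := sub_pos.2 hqq'
    have hev : ∀ᶠ n : ℕ in atTop, C - q' ≤ (q' - q) * n :=
      (tendsto_natCast_atTop_atTop.const_mul_atTop hpos).eventually_ge_atTop _
    rw [← map_add_atTop_eq_nat 1, frequently_map]
    refine (hx.and_eventually hev).mono fun n hn => ?_
    have h1 := hsub 1 n x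
    have h2 := (abs_le.1 (hgb 1 x)).2
    rw [add_comm 1 n] at h1
    simp only [Function.iterate_one, Nat.cast_one, mul_one] at h1 h2
    push_cast
    linarith [hn.1, hn.2]
  rcases hσ.ae_empty_or_univ_of_preimage_ae_le hAm.nullMeasurableSet
    (LE.le.eventuallyLE hinv) with h | h
  · have h' : ∀ᵐ x ∂μ, x ∉ A := measure_eq_zero_iff_ae_notMem.1 (ae_eq_empty.1 h)
    filter_upwards [h'] with x hx
    obtain ⟨q, hcq, hqd⟩ := exists_rat_btwn hcd
    by_contra hcon
    refine hx ⟨q, hqd, ?_⟩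
    rw [not_eventually] at hcon
    refine hcon.mono fun n hn => (not_lt.1 hn).trans ?_
    gcongr
  · exfalso
    refine absurd (le_of_forall_exists_small_block hσ.toMeasurePreserving hC hgm hgb hsub hlim
      (c := d) ?_) (not_le.2 hdL)
    filter_upwards [h] with x hx
    obtain ⟨q, hq, hx⟩ : x ∈ A := (eq_iff_iff.1 hx).2 trivial
    obtain ⟨n, hn, hn1⟩ := (hx.and_eventually (eventually_ge_atTop 1)).exists
    refine ⟨n, hn1, hn.trans ?_⟩
    gcongr

/-- The upper half of the subadditive ergodic theorem, for bounded cocycles over a transformation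
all of whose powers are ergodic. -/
theorem ae_eventually_gt_of_subadditive (hσ : ∀ n, 1 ≤ n → Ergodic (σ^[n]) μ) (hC : 0 ≤ C)
    (hgm : ∀ k, Measurable (g k)) (hgb : ∀ k x, |g k x| ≤ C * k)
    (hsub : ∀ k l x, g (k + l) x ≤ g k x + g l (σ^[k] x)) {L : ℝ}
    (hlim : Tendsto (fun k : ℕ => (∫ x, g k x ∂μ) / k) atTop (𝓝 L)) {c : ℝ} (hc : L < c) :
    ∀ᵐ x ∂μ, ∀ᶠ k : ℕ in atTop, g k x < c * k := by
  obtain ⟨d, hLd, hdc⟩ := exists_between hc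
  obtain ⟨n, hn, hn1⟩ := ((hlim.eventually (gt_mem_nhds hLd)).and (eventually_ge_atTop 1)).exists
  have hn0 : (0 : ℝ) < n := by exact_mod_cast hn1
  rw [div_lt_iff₀ hn0] at hn
  have hmp := (hσ n hn1).toMeasurePreserving
  have hneg : ∀ k x, |(-birkhoffSum (σ^[n]) (g n) k x)| ≤ (C * n) * k := by
    intro k x
    rw [abs_neg, birkhoffSum]
    refine (Finset.abs_sum_le_sum_abs _ _).trans ?_
    refine (Finset.sum_le_sum fun i _ => hgb n _).trans ?_
    simp [mul_comm]
  have hmeas : ∀ k, Measurable fun x => -birkhoffSum (σ^[n]) (g n) k x := fun k => by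
    simp only [birkhoffSum]
    exact (Finset.measurable_sum _ fun i _ => (hgm n).comp (hmp.measurable.iterate i)).neg
  -- Birkhoff sums of g n over σ^[n] are additive, so their negatives are subadditive as well; the
  -- lower half for them bounds g (q * n) from above along multiples of n.
  have hlow := ae_eventually_lt_of_subadditive (g := fun k x => -birkhoffSum (σ^[n]) (g n) k x)
    (hσ n hn1) (C := C * n) (by positivity) hmeas hneg
    (fun k l x => by rw [birkhoffSum_add]; linarith) (L := -∫ x, g n x ∂μ) (by
      refine tendsto_const_nhds.congr' ?_
      filter_upwards [eventually_gt_atTop 0] with k hk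
      have hk' : (k : ℝ) ≠ 0 := by positivity
      rw [integral_neg, integral_birkhoffSum hmp (hgm n)
        (integrable_of_abs_le (hgm n) (hgb n))]
      field_simp) (c := -(d * n)) (by linarith)
  filter_upwards [hlow] with x hx
  have hev : ∀ᶠ q : ℕ in atTop, g (q * n) x ≤ d * (q * n : ℕ) := by
    filter_upwards [hx] with q hq
    have := subadditive_mul_le_birkhoffSum hgb hsub n q x
    push_cast
    linarith
  have hdiv : Tendsto (fun k : ℕ => k / n) atTop atTop := Nat.tendsto_div_const_atTop (by omega)
  have hev2 : ∀ᶠ k : ℕ in atTop, (C + |d|) * n < (c - d) * k :=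
    (tendsto_natCast_atTop_atTop.const_mul_atTop (sub_pos.2 hdc)).eventually_gt_atTop _
  -- For k = qn + r with r < n, the remainder costs at most (C + |d|)n, which is eventually below (c
  -- - d)k.
  filter_upwards [hdiv.eventually hev, hev2] with k hk hk2
  have h1 := hsub (k / n * n) (k % n) x
  have h2 := (abs_le.1 (hgb (k % n) (σ^[k / n * n] x))).2
  have hr : ((k % n : ℕ) : ℝ) ≤ n := by exact_mod_cast (Nat.mod_lt k (by omega)).le
  have hkeq : k / n * n + k % n = k := Nat.div_add_mod' k n
  rw [hkeq] at h1
  have hkr : ((k / n * n : ℕ) : ℝ) = k - (k % n : ℕ) := by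
    rw [eq_sub_iff_add_eq]; exact_mod_cast hkeq
  rw [hkr] at hk
  have h3 : C * (k % n : ℕ) ≤ C * n := by gcongr
  have h4 : -(d * (k % n : ℕ)) ≤ |d| * n := by
    calc -(d * (k % n : ℕ)) = (-d) * (k % n : ℕ) := by ring
      _ ≤ |d| * (k % n : ℕ) := by gcongr; exact neg_le_abs d
      _ ≤ |d| * n := by gcongr
  linarith

end SubadditiveErgodic

/-! ### Ergodicity of all powers of the Bernoulli shift -/

section Shift

/-- The left shift on sequences. -/
def seqShift {α : Type*} (i : ℕ → α) : ℕ → α := fun n => i (n + 1)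

theorem seqShift_iterate {α : Type*} (k : ℕ) (i : ℕ → α) (n : ℕ) :
    (seqShift^[k] i) n = i (n + k) := by
  induction k generalizing i with
  | zero => rfl
  | succ k ih => rw [Function.iterate_succ_apply, ih]; simp only [seqShift]; congr 1

variable {α : Type*} [MeasurableSpace α]

theorem measurable_seqShift : Measurable (seqShift (α := α)) :=
  measurable_pi_lambda _ fun _ => measurable_pi_apply _

theorem measurePreserving_seqShift (ν : Measure α) [IsProbabilityMeasure ν] :
    MeasurePreserving seqShift (Measure.infinitePi fun _ : ℕ => ν)
      (Measure.infinitePi fun _ : ℕ => ν) := by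
  refine ⟨measurable_seqShift, Measure.eq_infinitePi _ fun s t ht => ?_⟩
  rw [Measure.map_apply measurable_seqShift (.pi s.countable_toSet fun _ _ => ht _)]
  have : seqShift ⁻¹' ((s : Set ℕ).pi t) =
      ((s.map (addRightEmbedding 1) : Finset ℕ) : Set ℕ).pi fun n => t (n - 1) := by
    ext i
    simp [seqShift, Set.mem_pi]
  rw [this, Measure.infinitePi_pi _ fun _ _ => ht _]
  simp

/-- An invariant set equals its preimage under arbitrarily high powers of the map, so it depends
only on coordinates beyond any given place. It is a tail event, and Kolmogorov's zero-one law
applies. -/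
theorem ergodic_seqShift_iterate (ν : Measure α) [IsProbabilityMeasure ν] {n : ℕ} (hn : 1 ≤ n) :
    Ergodic (seqShift^[n]) (Measure.infinitePi fun _ : ℕ => ν) := by
  refine ⟨(measurePreserving_seqShift ν).iterate n, ⟨fun A hA hinv => ?_⟩⟩
  let s : ℕ → MeasurableSpace (ℕ → α) := fun j =>
    MeasurableSpace.comap (fun i => i j) inferInstance
  have hle : ∀ j, s j ≤ MeasurableSpace.pi := fun j => (measurable_pi_apply j).comap_le
  have hind : ProbabilityTheory.iIndep s (Measure.infinitePi fun _ : ℕ => ν) :=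
    ProbabilityTheory.iIndepFun_infinitePi (P := fun _ : ℕ => ν) (X := fun _ x => x)
      fun _ => measurable_id
  have hk : ∀ k, (seqShift^[n * k]) ⁻¹' A = A := fun k => by
    rw [Function.iterate_mul]
    exact Set.preimage_iterate_eq ▸ Function.iterate_fixed hinv k
  have htail : MeasurableSet[limsup s atTop] A := by
    rw [limsup_eq_iInf_iSup_of_nat, MeasurableSpace.measurableSet_iInf]
    intro k
    rw [← hk k]
    have : Measurable[⨆ j ≥ k, s j] (seqShift^[n * k] : (ℕ → α) → ℕ → α) := by
      refine (@measurable_pi_iff _ _ _ (⨆ j ≥ k, s j) _ _).2 fun j => ?_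
      have h1 : (fun i : ℕ → α => (seqShift^[n * k] i) j) = fun i => i (j + n * k) := by
        funext i
        rw [seqShift_iterate]
      rw [h1]
      have h2 : s (j + n * k) ≤ ⨆ j ≥ k, s j := le_iSup₂_of_le (j + n * k) (by nlinarith) le_rfl
      exact (comap_measurable _).mono h2 le_rfl
    exact this hA
  rcases ProbabilityTheory.measure_zero_or_one_of_measurableSet_limsup_atTop hle hind htail
    with h | h
  · exact eventuallyConst_set'.2 (Or.inl (ae_eq_empty.2 h))
  · refine eventuallyConst_set'.2 (Or.inr ?_)
    rw [ae_eq_univ]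
    exact (prob_compl_eq_zero_iff hA).2 h

end Shift

namespace AlmostSelfAffine

/-! ### The singular value function in logarithmic form -/

section SingularValueFunction

/-- The exponent of the singular value with index `j` in `svf s`. -/
noncomputable def svfWeight (N : ℕ) (s : ℝ) (j : ℕ) : ℝ :=
  max 0 (min 1 (s - j)) + max 0 (s - N) / N

theorem svfWeight_nonneg (N : ℕ) (s : ℝ) (j : ℕ) : 0 ≤ svfWeight N s j := by
  unfold svfWeight
  positivity

theorem svfWeight_mono (N : ℕ) {s t : ℝ} (h : s ≤ t) (j : ℕ) :
    svfWeight N s j ≤ svfWeight N t j := by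
  unfold svfWeight
  gcongr

theorem svfWeight_antitone (N : ℕ) (s : ℝ) : Antitone (svfWeight N s) := by
  intro i j h
  unfold svfWeight
  gcongr

theorem sum_clamp {s : ℝ} (hs : 0 ≤ s) (n : ℕ) :
    ∑ j ∈ Finset.range n, max 0 (min 1 (s - j)) = min s n := by
  induction n with
  | zero => simp [hs]
  | succ n ih =>
    rw [Finset.sum_range_succ, ih]
    push_cast
    rcases le_total s n with h | h
    · rw [min_eq_left h, max_eq_left (min_le_of_right_le (by linarith)), add_zero,
        min_eq_left (by linarith)]
    · rw [min_eq_right h]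
      rcases le_total s (n + 1) with h' | h'
      · rw [min_eq_left h', min_eq_right (by linarith), max_eq_right (by linarith)]
        ring
      · rw [min_eq_right h', min_eq_left (by linarith), max_eq_right (by linarith)]

theorem sum_svfWeight {N : ℕ} (hN : 1 ≤ N) {s : ℝ} (hs : 0 ≤ s) :
    ∑ j ∈ Finset.range N, svfWeight N s j = s := by
  have hN0 : (N : ℝ) ≠ 0 := by positivity
  simp only [svfWeight]
  rw [Finset.sum_add_distrib, sum_clamp hs, Finset.sum_const, Finset.card_range, nsmul_eq_mul,
    mul_div_cancel₀ _ hN0]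
  rcases le_total s N with h | h
  · rw [min_eq_left h, max_eq_left (by linarith), add_zero]
  · rw [min_eq_right h, max_eq_right (by linarith)]
    ring

/-- Summation by parts, in inductive form: decreasing nonnegative weights preserve nonnegativity of
partial sums. -/
theorem sum_antitone_mul_nonneg {c z : ℕ → ℝ} (hc : Antitone c) (hc0 : ∀ j, 0 ≤ c j) {N : ℕ}
    (hz : ∀ n ≤ N, 0 ≤ ∑ j ∈ Finset.range n, z j) : 0 ≤ ∑ j ∈ Finset.range N, c j * z j := by
  have key : ∀ n ≤ N, c n * ∑ j ∈ Finset.range n, z j ≤ ∑ j ∈ Finset.range n, c j * z j := by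
    intro n hn
    induction n with
    | zero => simp
    | succ n ih =>
      have h1 := ih (by omega)
      have h2 := hz (n + 1) hn
      have h3 := mul_le_mul_of_nonneg_right (hc (Nat.le_succ n)) h2
      rw [Finset.sum_range_succ] at h3 ⊢
      rw [Finset.sum_range_succ]
      linarith
  exact (mul_nonneg (hc0 N) (hz N le_rfl)).trans (key N le_rfl)

variable {N : ℕ}

theorem singularValues_pos_of_injective
    {T : EuclideanSpace ℝ (Fin N) →L[ℝ] EuclideanSpace ℝ (Fin N)} (hT : Function.Injective T)
    {j : ℕ}
    (hj : j < N) : 0 < T.toLinearMap.singularValues j :=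
  T.toLinearMap.injective_iff_forall_lt_finrank_singularValues_pos.1 hT j (by simpa using hj)

theorem svf_pos {T : EuclideanSpace ℝ (Fin N) →L[ℝ] EuclideanSpace ℝ (Fin N)}
    (hT : Function.Injective T) {s : ℝ} (hs : 0 ≤ s) :
    0 < svf s T := by
  unfold svf
  split_ifs with h
  · have hfl : ⌊s⌋₊ ≤ N := Nat.floor_le_of_le h
    refine mul_pos (Finset.prod_pos fun j hj => singularValues_pos_of_injective hT
      ((Finset.mem_range.1 hj).trans_le hfl)) ?_
    rcases hfl.lt_or_eq with h1 | h1
    · exact Real.rpow_pos_of_pos (singularValues_pos_of_injective hT h1) _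
    -- Here s = N and the singular value of index N is the default value 0, but it carries the
    -- exponent 0 and contributes the factor 1.
    · have : s = ⌊s⌋₊ := le_antisymm (by rw [h1]; exact h) (Nat.floor_le hs)
      rw [← this, sub_self, Real.rpow_zero]
      exact one_pos
  · exact Real.rpow_pos_of_pos (Finset.prod_pos fun j hj => singularValues_pos_of_injective hT
      (Finset.mem_range.1 hj)) _

/-- Unifies the two branches of `svf` into one linear form in the logarithms of the singular values.
Its weights decrease in j, increase with s and have sum s; everything needed about `svf` follows
from this. -/
theorem log_svf {T : EuclideanSpace ℝ (Fin N) →L[ℝ] EuclideanSpace ℝ (Fin N)}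
    (hT : Function.Injective T) {s : ℝ} (hs : 0 ≤ s) :
    Real.log (svf s T) =
      ∑ j ∈ Finset.range N, svfWeight N s j * Real.log (T.toLinearMap.singularValues j) := by
  have hpos : ∀ j < N, 0 < T.toLinearMap.singularValues j := fun j hj =>
    singularValues_pos_of_injective hT hj
  unfold svf
  split_ifs with h
  · have hfl : ⌊s⌋₊ ≤ N := Nat.floor_le_of_le h
    have hw : ∀ j, svfWeight N s j = max 0 (min 1 (s - j)) := fun j => by
      rw [svfWeight, max_eq_left (sub_nonpos.2 h), zero_div, add_zero]
    have hw1 : ∀ j < ⌊s⌋₊, svfWeight N s j = 1 := fun j hj => by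
      have : (j : ℝ) + 1 ≤ s := by
        have h1 : ((j + 1 : ℕ) : ℝ) ≤ ⌊s⌋₊ := by exact_mod_cast hj
        push_cast at h1
        linarith [Nat.floor_le hs]
      rw [hw, min_eq_left (by linarith), max_eq_right (by linarith)]
    have hprod : ∏ j ∈ Finset.range ⌊s⌋₊, T.toLinearMap.singularValues j ≠ 0 :=
      (Finset.prod_pos fun j hj => hpos j ((Finset.mem_range.1 hj).trans_le hfl)).ne'
    have hlog : Real.log (∏ j ∈ Finset.range ⌊s⌋₊, T.toLinearMap.singularValues j) =
        ∑ j ∈ Finset.range ⌊s⌋₊, svfWeight N s j * Real.log (T.toLinearMap.singularValues j) := by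
      rw [Real.log_prod fun j hj => (hpos j ((Finset.mem_range.1 hj).trans_le hfl)).ne']
      exact Finset.sum_congr rfl fun j hj => by rw [hw1 j (Finset.mem_range.1 hj), one_mul]
    rcases hfl.lt_or_eq with h1 | h1
    · rw [Real.log_mul hprod (Real.rpow_pos_of_pos (hpos _ h1) _).ne', Real.log_rpow (hpos _ h1),
        hlog]
      have hlast : s - ⌊s⌋₊ = svfWeight N s ⌊s⌋₊ := by
        rw [hw, min_eq_right (by linarith [Nat.lt_floor_add_one s]),
          max_eq_right (by linarith [Nat.floor_le hs])]
      rw [hlast, ← Finset.sum_range_succ]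
      refine Finset.sum_subset (by simpa using h1) fun j _ hj => ?_
      have hj' : ⌊s⌋₊ + 1 ≤ j := by simpa using hj
      have h2 : ((⌊s⌋₊ + 1 : ℕ) : ℝ) ≤ j := by exact_mod_cast hj'
      push_cast at h2
      rw [hw, max_eq_left (min_le_of_right_le (by linarith [Nat.lt_floor_add_one s])), zero_mul]
    · have : s = ⌊s⌋₊ := le_antisymm (by rw [h1]; exact h) (Nat.floor_le hs)
      rw [← this, sub_self, Real.rpow_zero, mul_one, hlog, h1]
  · have hNs : (N : ℝ) < s := not_le.1 h
    rw [Real.log_rpow (Finset.prod_pos fun j hj => hpos j (Finset.mem_range.1 hj)),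
      Real.log_prod fun j hj => (hpos j (Finset.mem_range.1 hj)).ne', Finset.mul_sum]
    refine Finset.sum_congr rfl fun j hj => ?_
    have hjN : (j : ℝ) + 1 ≤ N := by exact_mod_cast Finset.mem_range.1 hj
    have hN0 : (N : ℝ) ≠ 0 := by linarith [(Nat.cast_nonneg j : (0 : ℝ) ≤ j)]
    rw [svfWeight, min_eq_left (by linarith), max_eq_right zero_le_one,
      max_eq_right (by linarith)]
    congr 1
    field_simp
    ring

/-- As the weights decrease, summation by parts reduces the claim to products of the first n
singular values for each n ≤ N. -/
theorem log_svf_mul_le {S T : EuclideanSpace ℝ (Fin N) →L[ℝ] EuclideanSpace ℝ (Fin N)}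
    (hS : Function.Injective S) (hT : Function.Injective T)
    {s : ℝ} (hs : 0 ≤ s) :
    Real.log (svf s (S * T)) ≤ Real.log (svf s S) + Real.log (svf s T) := by
  have hST : Function.Injective (S * T) := hS.comp hT
  rw [log_svf hS hs, log_svf hT hs, log_svf hST hs, ← sub_nonneg, ← Finset.sum_add_distrib,
    ← Finset.sum_sub_distrib]
  simp only [← mul_add, ← mul_sub]
  refine sum_antitone_mul_nonneg (svfWeight_antitone N s) (svfWeight_nonneg N s) fun n hn => ?_
  have hlog : ∀ R : EuclideanSpace ℝ (Fin N) →L[ℝ] EuclideanSpace ℝ (Fin N), Function.Injective R →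
      ∑ j ∈ Finset.range n, Real.log (R.toLinearMap.singularValues j) =
        Real.log (∏ j ∈ Finset.range n, R.toLinearMap.singularValues j) := fun R hR =>
    (Real.log_prod fun j hj => (singularValues_pos_of_injective hR
      ((Finset.mem_range.1 hj).trans_le hn)).ne').symm
  have hpos : ∀ R : EuclideanSpace ℝ (Fin N) →L[ℝ] EuclideanSpace ℝ (Fin N), Function.Injective R →
      0 < ∏ j ∈ Finset.range n, R.toLinearMap.singularValues j := fun R hR =>
    Finset.prod_pos fun j hj => singularValues_pos_of_injective hR
      ((Finset.mem_range.1 hj).trans_le hn)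
  rw [Finset.sum_sub_distrib, Finset.sum_add_distrib, hlog S hS, hlog T hT, hlog _ hST, sub_nonneg,
    ← Real.log_mul (hpos S hS).ne' (hpos T hT).ne']
  exact Real.log_le_log (hpos _ hST)
    (S.toLinearMap.prod_singularValues_comp_le T.toLinearMap hT (by simpa using hn))

theorem log_svf_sub_mem {T : EuclideanSpace ℝ (Fin N) →L[ℝ] EuclideanSpace ℝ (Fin N)} (hN : 1 ≤ N)
    (hT : Function.Injective T) {l u : ℝ}
    (hl : ∀ j < N, l ≤ Real.log (T.toLinearMap.singularValues j))
    (hu : ∀ j < N, Real.log (T.toLinearMap.singularValues j) ≤ u) {s t : ℝ} (hs : 0 ≤ s)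
    (hst : s ≤ t) :
    (t - s) * l ≤ Real.log (svf t T) - Real.log (svf s T) ∧
      Real.log (svf t T) - Real.log (svf s T) ≤ (t - s) * u := by
  have ht := hs.trans hst
  have hsum : ∑ j ∈ Finset.range N, (svfWeight N t j - svfWeight N s j) = t - s := by
    rw [Finset.sum_sub_distrib, sum_svfWeight hN hs, sum_svfWeight hN ht]
  rw [log_svf hT hs, log_svf hT ht, ← Finset.sum_sub_distrib, ← hsum, Finset.sum_mul,
    Finset.sum_mul]
  simp only [← sub_mul]
  exact ⟨Finset.sum_le_sum fun j hj => mul_le_mul_of_nonneg_left (hl j (Finset.mem_range.1 hj))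
      (sub_nonneg.2 (svfWeight_mono N hst j)),
    Finset.sum_le_sum fun j hj => mul_le_mul_of_nonneg_left (hu j (Finset.mem_range.1 hj))
      (sub_nonneg.2 (svfWeight_mono N hst j))⟩

theorem svf_zero (T : EuclideanSpace ℝ (Fin N) →L[ℝ] EuclideanSpace ℝ (Fin N)) : svf 0 T = 1 := by
  simp [svf]

end SingularValueFunction

/-! ### Finite words, their maps, and uniform contraction bounds -/

section Words

variable {m N : ℕ}

theorem curtail_length (i : ℕ → Fin m) (k : ℕ) : (curtail i k).length = k := by
  simp [curtail]

theorem curtail_add (i : ℕ → Fin m) (k l : ℕ) :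
    curtail i (k + l) = curtail i k ++ curtail (seqShift^[k] i) l := by
  refine List.ext_getElem (by simp [curtail]) fun n h1 h2 => ?_
  rw [List.getElem_append]
  split_ifs with h
  · simp [curtail]
  · simp only [curtail, List.length_ofFn, not_lt] at h
    simp only [curtail, List.getElem_ofFn, List.length_ofFn, seqShift_iterate]
    congr 1
    omega

theorem curtail_succ (i : ℕ → Fin m) (k : ℕ) : curtail i (k + 1) = curtail i k ++ [i k] := by
  rw [curtail_add]
  simp [curtail, seqShift_iterate]

variable (T : Fin m → EuclideanSpace ℝ (Fin N) →L[ℝ] EuclideanSpace ℝ (Fin N))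

theorem wordMap_nil : wordMap T [] = 1 := rfl

theorem wordMap_append (u v : List (Fin m)) : wordMap T (u ++ v) = wordMap T u * wordMap T v := by
  simp [wordMap]

theorem wordMap_cons (a : Fin m) (u : List (Fin m)) : wordMap T (a :: u) = T a * wordMap T u := by
  simp [wordMap]

theorem wordMap_singleton (a : Fin m) : wordMap T [a] = T a := by
  simp [wordMap]

variable {T}

theorem wordMap_injective (hTi : ∀ a, Function.Injective (T a)) (u : List (Fin m)) :
    Function.Injective (wordMap T u) := by
  induction u with
  | nil => exact fun _ _ h => h
  | cons a u ih => rw [wordMap_cons]; exact (hTi a).comp ih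

theorem norm_wordMap_apply_le {a : ℝ} (ha0 : 0 ≤ a) (ha : ∀ c, ‖T c‖ ≤ a) (u : List (Fin m))
    (x : EuclideanSpace ℝ (Fin N)) : ‖wordMap T u x‖ ≤ a ^ u.length * ‖x‖ := by
  induction u with
  | nil => simp [wordMap_nil]
  | cons c u ih =>
    rw [wordMap_cons, List.length_cons, pow_succ', mul_assoc]
    exact ((T c).le_opNorm _).trans (mul_le_mul (ha c) ih (norm_nonneg _) ha0)

theorem le_norm_wordMap_apply {b : ℝ} (hb0 : 0 ≤ b) (hb : ∀ c x, b * ‖x‖ ≤ ‖T c x‖)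
    (u : List (Fin m)) (x : EuclideanSpace ℝ (Fin N)) : b ^ u.length * ‖x‖ ≤ ‖wordMap T u x‖ := by
  induction u with
  | nil => simp [wordMap_nil]
  | cons c u ih =>
    rw [wordMap_cons, List.length_cons, pow_succ', mul_assoc]
    exact (mul_le_mul_of_nonneg_left ih hb0).trans (hb c _)

theorem exists_norm_le_of_contractions (hTc : ∀ a, ‖T a‖ < 1) :
    ∃ a : ℝ, 0 < a ∧ a < 1 ∧ ∀ c, ‖T c‖ ≤ a := by
  have h : ∀ᶠ a : ℝ in 𝓝[<] 1, ∀ c, ‖T c‖ ≤ a := by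
    rw [eventually_all]
    intro c
    filter_upwards [Ioo_mem_nhdsLT (hTc c)] with a ha using ha.1.le
  obtain ⟨a, h1, h2⟩ := (h.and (Ioo_mem_nhdsLT (zero_lt_one' ℝ))).exists
  exact ⟨a, h2.1, h2.2, h1⟩

theorem exists_le_norm_of_injective (hTi : ∀ a, Function.Injective (T a)) :
    ∃ b : ℝ, 0 < b ∧ ∀ c x, b * ‖x‖ ≤ ‖T c x‖ := by
  have h : ∀ᶠ b : ℝ in 𝓝[>] 0, ∀ c x, b * ‖x‖ ≤ ‖T c x‖ := by
    rw [eventually_all]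
    intro c
    obtain ⟨K, hK, hKT⟩ := (T c).toLinearMap.exists_antilipschitzWith
      (LinearMap.ker_eq_bot.2 (hTi c))
    have hK' : (0 : ℝ) < K := hK
    filter_upwards [Ioo_mem_nhdsGT (inv_pos.2 hK')] with b hb x
    have h1 : ‖x‖ ≤ K * ‖T c x‖ := by simpa using hKT.le_mul_dist x 0
    calc b * ‖x‖ ≤ (K : ℝ)⁻¹ * ‖x‖ := by gcongr; exact hb.2.le
      _ ≤ ‖T c x‖ := by rw [inv_mul_le_iff₀ hK']; exact h1
  obtain ⟨b, h1, h2⟩ := (h.and self_mem_nhdsWithin).exists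
  exact ⟨b, h2, h1⟩

theorem log_singularValues_wordMap_mem {a b : ℝ} (ha0 : 0 < a) (ha : ∀ c, ‖T c‖ ≤ a) (hb0 : 0 < b)
    (hb : ∀ c x, b * ‖x‖ ≤ ‖T c x‖) (u : List (Fin m)) {j : ℕ} (hj : j < N) :
    u.length * Real.log b ≤ Real.log ((wordMap T u).toLinearMap.singularValues j) ∧
      Real.log ((wordMap T u).toLinearMap.singularValues j) ≤ u.length * Real.log a := by
  have h1 : b ^ u.length ≤ (wordMap T u).toLinearMap.singularValues j :=
    LinearMap.le_singularValues_of_le_norm _ (le_norm_wordMap_apply hb0.le hb u) (by simpa using hj)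
  have h2 : (wordMap T u).toLinearMap.singularValues j ≤ a ^ u.length :=
    LinearMap.singularValues_le_of_norm_le _ (by positivity)
      (norm_wordMap_apply_le ha0.le ha u) j
  rw [← Real.log_pow, ← Real.log_pow]
  exact ⟨Real.log_le_log (by positivity) h1,
    Real.log_le_log (lt_of_lt_of_le (by positivity) h1) h2⟩

end Words

end AlmostSelfAffine

namespace AlmostSelfAffine

/-! ### The Bernoulli measure on code space -/

section Bernoulli

variable {m : ℕ} {p : Fin m → ℝ}

theorem isProbabilityMeasure_letter (hp : ∀ a, 0 < p a) (hp1 : ∑ a, p a = 1) :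
    IsProbabilityMeasure (∑ a : Fin m, ENNReal.ofReal (p a) • Measure.dirac a) := by
  constructor
  simp [← ENNReal.ofReal_sum_of_nonneg (fun a _ => (hp a).le), hp1]

theorem isProbabilityMeasure_bernoulliMeasure (hp : ∀ a, 0 < p a) (hp1 : ∑ a, p a = 1) :
    IsProbabilityMeasure (bernoulliMeasure p) := by
  have := isProbabilityMeasure_letter hp hp1
  unfold bernoulliMeasure
  infer_instance

theorem ergodic_bernoulliMeasure (hp : ∀ a, 0 < p a) (hp1 : ∑ a, p a = 1) {n : ℕ} (hn : 1 ≤ n) :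
    Ergodic (seqShift^[n]) (bernoulliMeasure p) := by
  have := isProbabilityMeasure_letter hp hp1
  exact ergodic_seqShift_iterate _ hn

theorem word_prod_pos (hp : ∀ a, 0 < p a) (u : List (Fin m)) : 0 < (u.map p).prod := by
  refine List.prod_pos fun x hx => ?_
  obtain ⟨a, -, rfl⟩ := List.mem_map.1 hx
  exact hp a

theorem measureReal_cyl (hp : ∀ a, 0 < p a) (hp1 : ∑ a, p a = 1) (u : List (Fin m)) :
    (bernoulliMeasure p).real (cyl u) = (u.map p).prod := by
  rw [Measure.real, bernoulliMeasure_cyl p hp hp1, ENNReal.toReal_ofReal (word_prod_pos hp u).le]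

theorem measurable_curtail (k : ℕ) : Measurable fun (i : ℕ → Fin m) (j : Fin k) => i j :=
  measurable_pi_lambda _ fun _ => measurable_pi_apply _

theorem measurable_comp_curtail {β : Type*} [MeasurableSpace β] (f : List (Fin m) → β) (k : ℕ) :
    Measurable fun i : ℕ → Fin m => f (curtail i k) :=
  (measurable_of_countable fun u : Fin k → Fin m => f (List.ofFn u)).comp (measurable_curtail k)

theorem measurableSet_cyl (u : List (Fin m)) : MeasurableSet (cyl u) := by
  have := measurable_comp_curtail (m := m) (β := Prop) (fun v => v = u) u.length
  exact measurableSet_setOfPred.2 this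

/-- Turns the weighted sums over words in the pressure into integrals, to which ergodic theory
applies. -/
theorem integral_comp_curtail (hp : ∀ a, 0 < p a) (hp1 : ∑ a, p a = 1) (f : List (Fin m) → ℝ)
    (k : ℕ) : ∫ i, f (curtail i k) ∂(bernoulliMeasure p) =
      ∑ u : Fin k → Fin m, (bernoulliMeasure p).real (cyl (List.ofFn u)) * f (List.ofFn u) := by
  have := isProbabilityMeasure_bernoulliMeasure hp hp1
  have := Measure.isProbabilityMeasure_map (μ := bernoulliMeasure p)
    (measurable_curtail (m := m) k).aemeasurable
  have h1 := integral_map (μ := bernoulliMeasure p) (measurable_curtail k).aemeasurable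
    (f := fun u : Fin k → Fin m => f (List.ofFn u))
    (measurable_of_countable _).aestronglyMeasurable
  simp only [curtail]
  rw [← h1, integral_fintype .of_finite]
  refine Finset.sum_congr rfl fun u _ => ?_
  rw [smul_eq_mul, map_measureReal_apply (measurable_curtail k) (measurableSet_singleton u)]
  congr 2
  ext i
  simp only [cyl, Set.mem_preimage, Set.mem_singleton_iff, Set.mem_ofPred_eq]
  constructor
  · rintro rfl
    simp only [curtail]
    exact List.ext_getElem (by simp) (by simp)
  · intro h
    funext j
    have := congrArg (fun l => l[(j : ℕ)]?) h
    simpa [curtail] using this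

theorem measure_eq_of_curtail_eq (i : ℕ → Fin m) (k : ℕ) : i ∈ cyl (curtail i k) := by
  simp [cyl, curtail_length]

end Bernoulli

/-! ### The pressure: existence, monotonicity, its zero, almost sure growth rates -/

section Pressure

variable {m N : ℕ} (T : Fin m → EuclideanSpace ℝ (Fin N) →L[ℝ] EuclideanSpace ℝ (Fin N))
  (p : Fin m → ℝ)

/-- The logarithm of `φ^s(T_u) / μ(C_u)`. -/
noncomputable def wordCocycle (s : ℝ) (u : List (Fin m)) : ℝ :=
  Real.log (svf s (wordMap T u)) - Real.log (u.map p).prod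

variable {T p}

theorem wordCocycle_append_le (hTi : ∀ a, Function.Injective (T a)) (hp : ∀ a, 0 < p a) {s : ℝ}
    (hs : 0 ≤ s) (u v : List (Fin m)) :
    wordCocycle T p s (u ++ v) ≤ wordCocycle T p s u + wordCocycle T p s v := by
  have h := log_svf_mul_le (wordMap_injective hTi u) (wordMap_injective hTi v) hs
  unfold wordCocycle
  rw [wordMap_append, List.map_append, List.prod_append,
    Real.log_mul (word_prod_pos hp u).ne' (word_prod_pos hp v).ne']
  linarith

/-- The sign changes: the pressure is minus the growth rate of the cocycle, because φ^s enters it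
inverted. -/
theorem hasPressureOne_iff (hTi : ∀ a, Function.Injective (T a)) (hp : ∀ a, 0 < p a)
    (hp1 : ∑ a, p a = 1) {s : ℝ} (hs : 0 ≤ s) (L : ℝ) :
    HasPressureOne T (bernoulliMeasure p) s L ↔
      Tendsto (fun k : ℕ => (∫ i, wordCocycle T p s (curtail i k) ∂(bernoulliMeasure p)) / k) atTop
        (𝓝 (-L)) := by
  unfold HasPressureOne
  rw [← tendsto_neg_iff]
  refine tendsto_congr fun k => ?_
  rw [integral_comp_curtail hp hp1, one_div, div_eq_inv_mul, ← mul_neg, ← Finset.sum_neg_distrib]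
  congr 1
  refine Finset.sum_congr rfl fun u _ => ?_
  rw [Real.log_mul (inv_pos.2 (svf_pos (wordMap_injective hTi _) hs)).ne'
    (by rw [measureReal_cyl hp hp1]; exact (word_prod_pos hp _).ne'), Real.log_inv,
    measureReal_cyl hp hp1, wordCocycle]
  ring

theorem wordCocycle_sub_mem (hN : 1 ≤ N) (hTi : ∀ a, Function.Injective (T a)) {a b : ℝ}
    (ha0 : 0 < a) (ha : ∀ c, ‖T c‖ ≤ a) (hb0 : 0 < b) (hb : ∀ c x, b * ‖x‖ ≤ ‖T c x‖) {s t : ℝ}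
    (hs : 0 ≤ s) (hst : s ≤ t) (u : List (Fin m)) :
    (t - s) * (u.length * Real.log b) ≤ wordCocycle T p t u - wordCocycle T p s u ∧
      wordCocycle T p t u - wordCocycle T p s u ≤ (t - s) * (u.length * Real.log a) := by
  have h := log_svf_sub_mem hN (wordMap_injective hTi u)
    (fun j hj => (log_singularValues_wordMap_mem ha0 ha hb0 hb u hj).1)
    (fun j hj => (log_singularValues_wordMap_mem ha0 ha hb0 hb u hj).2) hs hst
  unfold wordCocycle
  constructor <;> linarith [h.1, h.2]

theorem exists_abs_log_prod_le (hp : ∀ a, 0 < p a) :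
    ∃ D : ℝ, 0 ≤ D ∧ ∀ u : List (Fin m), |Real.log (u.map p).prod| ≤ D * u.length := by
  refine ⟨∑ a, |Real.log (p a)|, by positivity, fun u => ?_⟩
  induction u with
  | nil => simp
  | cons c u ih =>
    rw [List.map_cons, List.prod_cons, Real.log_mul (hp c).ne' (word_prod_pos hp u).ne',
      List.length_cons]
    push_cast
    have h1 := abs_add_le (Real.log (p c)) (Real.log (u.map p).prod)
    have h2 : |Real.log (p c)| ≤ ∑ a, |Real.log (p a)| :=
      Finset.single_le_sum (f := fun a => |Real.log (p a)|) (fun a _ => abs_nonneg _)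
        (Finset.mem_univ c)
    linarith

theorem exists_abs_wordCocycle_le (hN : 1 ≤ N) (hTc : ∀ a, ‖T a‖ < 1)
    (hTi : ∀ a, Function.Injective (T a)) (hp : ∀ a, 0 < p a) {s : ℝ} (hs : 0 ≤ s) :
    ∃ D : ℝ, 0 ≤ D ∧ ∀ u : List (Fin m), |wordCocycle T p s u| ≤ D * u.length := by
  obtain ⟨a, ha0, ha1, ha⟩ := exists_norm_le_of_contractions hTc
  obtain ⟨b, hb0, hb⟩ := exists_le_norm_of_injective hTi
  obtain ⟨D, hD0, hD⟩ := exists_abs_log_prod_le hp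
  -- Comparison with s = 0, where the cocycle is minus the logarithm of the word's probability.
  refine ⟨D + s * |Real.log b|, by positivity, fun u => ?_⟩
  have h := wordCocycle_sub_mem (p := p) hN hTi ha0 ha hb0 hb le_rfl hs u
  have h0 : wordCocycle T p 0 u = -Real.log (u.map p).prod := by
    simp [wordCocycle, svf_zero]
  have hl : Real.log a ≤ 0 := Real.log_nonpos ha0.le ha1.le
  have h1 : s * (u.length * Real.log a) ≤ 0 :=
    mul_nonpos_of_nonneg_of_nonpos hs (mul_nonpos_of_nonneg_of_nonpos (by positivity) hl)
  have h2 : -(s * (u.length * |Real.log b|)) ≤ s * (u.length * Real.log b) := by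
    rw [← mul_neg, ← mul_neg]
    gcongr
    exact neg_abs_le _
  have h3 := abs_le.1 (hD u)
  have h4 : 0 ≤ s * (u.length * |Real.log b|) := by positivity
  rw [h0, sub_zero] at h
  rw [abs_le]
  constructor <;> linarith [h.1, h.2]

theorem wordCocycle_curtail_add_le (hTi : ∀ a, Function.Injective (T a)) (hp : ∀ a, 0 < p a)
    {s : ℝ} (hs : 0 ≤ s) (k l : ℕ) (i : ℕ → Fin m) :
    wordCocycle T p s (curtail i (k + l)) ≤
      wordCocycle T p s (curtail i k) + wordCocycle T p s (curtail (seqShift^[k] i) l) := by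
  rw [curtail_add]
  exact wordCocycle_append_le hTi hp hs _ _

theorem integrable_wordCocycle (hp : ∀ a, 0 < p a) (hp1 : ∑ a, p a = 1) (s : ℝ) (k : ℕ) :
    Integrable (fun i => wordCocycle T p s (curtail i k)) (bernoulliMeasure p) := by
  have := isProbabilityMeasure_bernoulliMeasure hp hp1
  have := Measure.isProbabilityMeasure_map (μ := bernoulliMeasure p)
    (measurable_curtail (m := m) k).aemeasurable
  exact Integrable.comp_measurable (g := fun u : Fin k → Fin m => wordCocycle T p s (List.ofFn u))
    .of_finite (measurable_curtail k)

/-- Fekete's lemma: shift invariance makes the integrals of the cocycle subadditive in k, and the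
linear bound keeps the limit finite. -/
theorem exists_hasPressureOne (hN : 1 ≤ N) (hTc : ∀ a, ‖T a‖ < 1)
    (hTi : ∀ a, Function.Injective (T a)) (hp : ∀ a, 0 < p a) (hp1 : ∑ a, p a = 1) {s : ℝ}
    (hs : 0 ≤ s) : ∃ L, HasPressureOne T (bernoulliMeasure p) s L := by
  have := isProbabilityMeasure_bernoulliMeasure hp hp1
  obtain ⟨D, hD0, hD⟩ := exists_abs_wordCocycle_le hN hTc hTi hp hs
  have hint := integrable_wordCocycle (T := T) hp hp1 s
  have hsub : Subadditive fun k =>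
      ∫ i, wordCocycle T p s (curtail i k) ∂(bernoulliMeasure p) := by
    intro k l
    have hmp := (ergodic_bernoulliMeasure hp hp1 le_rfl).toMeasurePreserving.iterate k
    rw [Function.iterate_one] at hmp
    have h1 : ∫ i, wordCocycle T p s (curtail (seqShift^[k] i) l) ∂(bernoulliMeasure p) =
        ∫ i, wordCocycle T p s (curtail i l) ∂(bernoulliMeasure p) := by
      have := integral_map (μ := bernoulliMeasure p) hmp.aemeasurable
        (f := fun i => wordCocycle T p s (curtail i l))
        (measurable_comp_curtail (wordCocycle T p s) l).aestronglyMeasurable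
      rw [← this, hmp.map_eq]
    have h2 : Integrable (fun i => wordCocycle T p s (curtail (seqShift^[k] i) l))
      (bernoulliMeasure p) := hmp.integrable_comp_of_integrable (hint l)
    simp only
    rw [← h1, ← integral_add (hint k) h2]
    exact integral_mono (hint _) ((hint k).add h2) fun i =>
      wordCocycle_curtail_add_le hTi hp hs k l i
  have hbdd : BddBelow (Set.range fun k : ℕ =>
      (∫ i, wordCocycle T p s (curtail i k) ∂(bernoulliMeasure p)) / k) := by
    refine ⟨-D, ?_⟩
    rintro _ ⟨k, rfl⟩
    rcases Nat.eq_zero_or_pos k with rfl | hk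
    · simpa using hD0
    · have hk' : (0 : ℝ) < k := by exact_mod_cast hk
      simp only
      rw [le_div_iff₀ hk']
      calc -D * k = ∫ _i : ℕ → Fin m, -D * k ∂(bernoulliMeasure p) := by simp
        _ ≤ _ := integral_mono (integrable_const _) (hint k) fun i => by
          have := (abs_le.1 (hD (curtail i k))).1
          rw [curtail_length] at this
          linarith
  refine ⟨-hsub.lim, (hasPressureOne_iff hTi hp hp1 hs _).2 ?_⟩
  rw [neg_neg]
  exact hsub.tendsto_lim hbdd

theorem hasPressureOne_sub_mem (hN : 1 ≤ N) (hTi : ∀ a, Function.Injective (T a))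
    (hp : ∀ a, 0 < p a) (hp1 : ∑ a, p a = 1) {a b : ℝ} (ha0 : 0 < a) (ha : ∀ c, ‖T c‖ ≤ a)
    (hb0 : 0 < b) (hb : ∀ c x, b * ‖x‖ ≤ ‖T c x‖) {s t L M : ℝ} (hs : 0 ≤ s) (hst : s ≤ t)
    (hL : HasPressureOne T (bernoulliMeasure p) s L)
    (hM : HasPressureOne T (bernoulliMeasure p) t M) :
    (t - s) * -Real.log a ≤ M - L ∧ M - L ≤ (t - s) * -Real.log b := by
  have := isProbabilityMeasure_bernoulliMeasure hp hp1
  rw [hasPressureOne_iff hTi hp hp1 hs] at hL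
  rw [hasPressureOne_iff hTi hp hp1 (hs.trans hst)] at hM
  have hdiff := hL.sub hM
  rw [neg_sub_neg] at hdiff
  have hints := integrable_wordCocycle (T := T) hp hp1 s
  have hintt := integrable_wordCocycle (T := T) hp hp1 t
  have hw := fun (i : ℕ → Fin m) k =>
    wordCocycle_sub_mem (p := p) hN hTi ha0 ha hb0 hb hs hst (curtail i k)
  simp only [curtail_length] at hw
  constructor
  · refine ge_of_tendsto hdiff ?_
    filter_upwards [eventually_gt_atTop 0] with k hk
    have hk' : (0 : ℝ) < k := by exact_mod_cast hk
    rw [← sub_div, le_div_iff₀ hk', ← integral_sub (hints k) (hintt k)]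
    calc _ = ∫ _i : ℕ → Fin m, (t - s) * -Real.log a * k ∂(bernoulliMeasure p) := by simp
      _ ≤ _ := integral_mono (integrable_const _) ((hints k).sub (hintt k)) fun i => by
        rw [Pi.sub_apply]
        linarith [(hw i k).2]
  · refine le_of_tendsto hdiff ?_
    filter_upwards [eventually_gt_atTop 0] with k hk
    have hk' : (0 : ℝ) < k := by exact_mod_cast hk
    rw [← sub_div, div_le_iff₀ hk', ← integral_sub (hints k) (hintt k)]
    calc _ ≤ ∫ _i : ℕ → Fin m, (t - s) * -Real.log b * k ∂(bernoulliMeasure p) :=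
        integral_mono ((hints k).sub (hintt k)) (integrable_const _) fun i => by
          rw [Pi.sub_apply]
          linarith [(hw i k).1]
      _ = _ := by simp

theorem lt_one_of_two_le (hm : 2 ≤ m) (hp : ∀ a, 0 < p a) (hp1 : ∑ a, p a = 1) (a : Fin m) :
    p a < 1 := by
  have : Nontrivial (Fin m) := Fin.nontrivial_iff_two_le.2 hm
  obtain ⟨c, hc⟩ := exists_ne a
  rw [← hp1]
  exact Finset.single_lt_sum hc (Finset.mem_univ a) (Finset.mem_univ c) (hp c)
    fun k _ _ => (hp k).le

/-- At s = 0 the pressure is minus the entropy. It is bounded away from 0 by the logarithm of the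
largest letter probability, which is below 1 as there are at least two letters. -/
theorem hasPressureOne_zero_neg (hm : 2 ≤ m) (hTi : ∀ a, Function.Injective (T a))
    (hp : ∀ a, 0 < p a) (hp1 : ∑ a, p a = 1) {L : ℝ}
    (hL : HasPressureOne T (bernoulliMeasure p) 0 L) : L < 0 := by
  have := isProbabilityMeasure_bernoulliMeasure hp hp1
  rw [hasPressureOne_iff hTi hp hp1 le_rfl] at hL
  have : Nonempty (Fin m) := ⟨⟨0, by omega⟩⟩
  obtain ⟨c, -, hc⟩ := Finset.exists_max_image Finset.univ p Finset.univ_nonempty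
  have hlogc : Real.log (p c) < 0 := Real.log_neg (hp c) (lt_one_of_two_le hm hp hp1 c)
  have hw : ∀ u : List (Fin m), u.length * -Real.log (p c) ≤ wordCocycle T p 0 u := by
    intro u
    simp only [wordCocycle, svf_zero, Real.log_one, zero_sub]
    induction u with
    | nil => simp
    | cons a u ih =>
      rw [List.map_cons, List.prod_cons, Real.log_mul (hp a).ne' (word_prod_pos hp u).ne',
        List.length_cons]
      push_cast
      have := Real.log_le_log (hp a) (hc a (Finset.mem_univ a))
      linarith
  have : -Real.log (p c) ≤ -L := by
    refine ge_of_tendsto hL ?_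
    filter_upwards [eventually_gt_atTop 0] with k hk
    have hk' : (0 : ℝ) < k := by exact_mod_cast hk
    rw [le_div_iff₀ hk']
    calc _ = ∫ _i : ℕ → Fin m, -Real.log (p c) * k ∂(bernoulliMeasure p) := by simp
      _ ≤ _ := integral_mono (integrable_const _) (integrable_wordCocycle hp hp1 0 k) fun i => by
        have := hw (curtail i k)
        rw [curtail_length] at this
        simp only
        linarith
  linarith

theorem hasPressureOne_lt (hN : 1 ≤ N) (hTc : ∀ a, ‖T a‖ < 1)
    (hTi : ∀ a, Function.Injective (T a)) (hp : ∀ a, 0 < p a) (hp1 : ∑ a, p a = 1) {s t L M : ℝ}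
    (hs : 0 ≤ s) (hst : s < t) (hL : HasPressureOne T (bernoulliMeasure p) s L)
    (hM : HasPressureOne T (bernoulliMeasure p) t M) : L < M := by
  obtain ⟨a, ha0, ha1, ha⟩ := exists_norm_le_of_contractions hTc
  obtain ⟨b, hb0, hb⟩ := exists_le_norm_of_injective hTi
  have h := (hasPressureOne_sub_mem hN hTi hp hp1 ha0 ha hb0 hb hs hst.le hL hM).1
  have := mul_pos (sub_pos.2 hst) (neg_pos.2 (Real.log_neg ha0 ha1))
  linarith

theorem existsUnique_hasPressureOne_zero (hm : 2 ≤ m) (hN : 1 ≤ N) (hTc : ∀ a, ‖T a‖ < 1)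
    (hTi : ∀ a, Function.Injective (T a)) (hp : ∀ a, 0 < p a) (hp1 : ∑ a, p a = 1) :
    ∃! d : ℝ, 0 < d ∧ HasPressureOne T (bernoulliMeasure p) d 0 := by
  obtain ⟨a, ha0, ha1, ha⟩ := exists_norm_le_of_contractions hTc
  obtain ⟨b, hb0, hb⟩ := exists_le_norm_of_injective hTi
  have hex : ∀ s : ℝ, ∃ L, 0 ≤ s → HasPressureOne T (bernoulliMeasure p) s L := fun s => by
    by_cases hs : 0 ≤ s
    · obtain ⟨L, hL⟩ := exists_hasPressureOne hN hTc hTi hp hp1 hs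
      exact ⟨L, fun _ => hL⟩
    · exact ⟨0, fun h => absurd h hs⟩
  choose Q hQ using hex
  have hla : 0 < -Real.log a := neg_pos.2 (Real.log_neg ha0 ha1)
  have hQ0 : Q 0 < 0 := hasPressureOne_zero_neg hm hTi hp hp1 (hQ 0 le_rfl)
  have hmem : ∀ s t, 0 ≤ s → s ≤ t → (t - s) * -Real.log a ≤ Q t - Q s ∧
      Q t - Q s ≤ (t - s) * -Real.log b := fun s t hs hst =>
    hasPressureOne_sub_mem hN hTi hp hp1 ha0 ha hb0 hb hs hst (hQ s hs) (hQ t (hs.trans hst))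
  -- Q has slope at least -log a > 0, so starting from Q 0 < 0 it has reached 0 by this t.
  let t := Q 0 / Real.log a
  have ht : 0 ≤ t := (div_pos_of_neg_of_neg hQ0 (by linarith)).le
  have hQt : 0 ≤ Q t := by
    have h1 := (hmem 0 t le_rfl ht).1
    have h2 : t * Real.log a = Q 0 := div_mul_cancel₀ _ (by linarith)
    linarith
  have hcont : ContinuousOn Q (Set.Icc 0 t) := by
    have : LipschitzOnWith (Real.toNNReal |Real.log b|) Q (Set.Icc 0 t) := by
      refine LipschitzOnWith.of_le_add_mul' _ fun x hx y hy => ?_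
      rw [Real.dist_eq]
      have hlb := neg_le_abs (Real.log b)
      have h0 := abs_nonneg (Real.log b)
      rcases le_total x y with h | h
      · have h1 := (hmem x y hx.1 h).1
        have h2 := mul_nonneg (sub_nonneg.2 h) hla.le
        have h3 := mul_nonneg h0 (abs_nonneg (x - y))
        linarith
      · have h1 := (hmem y x hy.1 h).2
        have h2 := mul_le_mul_of_nonneg_left hlb (sub_nonneg.2 h)
        rw [abs_of_nonneg (sub_nonneg.2 h)]
        linarith
    exact this.continuousOn
  obtain ⟨d, hd, hd0⟩ := intermediate_value_Icc ht hcont ⟨hQ0.le, hQt⟩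
  have hdpos : 0 < d := by
    rcases hd.1.lt_or_eq with h | h
    · exact h
    · rw [← h] at hd0
      linarith
  have hd' := hQ d hd.1
  rw [hd0] at hd'
  refine ⟨d, ⟨hdpos, hd'⟩, fun e he => ?_⟩
  rcases lt_trichotomy e d with h | h | h
  · exact absurd (hasPressureOne_lt hN hTc hTi hp hp1 he.1.le h he.2 hd') (lt_irrefl _)
  · exact h
  · exact absurd (hasPressureOne_lt hN hTc hTi hp hp1 hdpos.le h hd' he.2) (lt_irrefl _)

theorem ae_eventually_lt_wordCocycle (hN : 1 ≤ N) (hTc : ∀ a, ‖T a‖ < 1)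
    (hTi : ∀ a, Function.Injective (T a)) (hp : ∀ a, 0 < p a) (hp1 : ∑ a, p a = 1) {s L c : ℝ}
    (hs : 0 ≤ s) (hL : HasPressureOne T (bernoulliMeasure p) s L) (hc : c < -L) :
    ∀ᵐ i ∂(bernoulliMeasure p), ∀ᶠ k : ℕ in atTop, c * k < wordCocycle T p s (curtail i k) := by
  have := isProbabilityMeasure_bernoulliMeasure hp hp1
  obtain ⟨D, hD0, hD⟩ := exists_abs_wordCocycle_le hN hTc hTi hp hs
  have herg := ergodic_bernoulliMeasure hp hp1 le_rfl
  rw [Function.iterate_one] at herg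
  exact ae_eventually_lt_of_subadditive (g := fun k i => wordCocycle T p s (curtail i k)) herg hD0
    (measurable_comp_curtail _) (fun k i => by simpa [curtail_length] using hD (curtail i k))
    (wordCocycle_curtail_add_le hTi hp hs) ((hasPressureOne_iff hTi hp hp1 hs L).1 hL) hc

theorem ae_eventually_wordCocycle_lt (hN : 1 ≤ N) (hTc : ∀ a, ‖T a‖ < 1)
    (hTi : ∀ a, Function.Injective (T a)) (hp : ∀ a, 0 < p a) (hp1 : ∑ a, p a = 1) {s L c : ℝ}
    (hs : 0 ≤ s) (hL : HasPressureOne T (bernoulliMeasure p) s L) (hc : -L < c) :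
    ∀ᵐ i ∂(bernoulliMeasure p), ∀ᶠ k : ℕ in atTop, wordCocycle T p s (curtail i k) < c * k := by
  have := isProbabilityMeasure_bernoulliMeasure hp hp1
  obtain ⟨D, hD0, hD⟩ := exists_abs_wordCocycle_le hN hTc hTi hp hs
  exact ae_eventually_gt_of_subadditive (g := fun k i => wordCocycle T p s (curtail i k))
    (fun n hn => ergodic_bernoulliMeasure hp hp1 hn) hD0
    (measurable_comp_curtail _) (fun k i => by simpa [curtail_length] using hD (curtail i k))
    (wordCocycle_curtail_add_le hTi hp hs) ((hasPressureOne_iff hTi hp hp1 hs L).1 hL) hc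

end Pressure

end AlmostSelfAffine

namespace AlmostSelfAffine

/-! ### From power bounds on balls to local and information dimension -/

section LocalDimension

variable {N : ℕ}

variable {ν : Measure (EuclideanSpace ℝ (Fin N))} {d : ℝ}

theorem norm_le_of_abs_inner_le (f : OrthonormalBasis (Fin N) ℝ (EuclideanSpace ℝ (Fin N)))
    {x : EuclideanSpace ℝ (Fin N)} {r : ℝ} (hr : 0 ≤ r)
    (h : ∀ l, |inner ℝ x (f l)| ≤ r) : ‖x‖ ≤ √N * r := by
  refine le_of_sq_le_sq ?_ (by positivity)
  rw [mul_pow, Real.sq_sqrt (by positivity), ← f.sum_sq_norm_inner_left x]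
  calc ∑ i, ‖inner ℝ x (f i)‖ ^ 2 ≤ ∑ _i : Fin N, r ^ 2 := Finset.sum_le_sum fun i _ => by
        rw [Real.norm_eq_abs]
        exact pow_le_pow_left₀ (abs_nonneg _) (h i) 2
    _ = N * r ^ 2 := by simp

/-- The exceptional null set may depend on s, so only the countably many exponents d ± 1/(n+1) are
used. -/
theorem isExactOfDimension_of_bounds
    (hlow : ∀ s < d, ∀ᵐ x ∂ν, ∀ᶠ r in 𝓝[>] (0 : ℝ), ν.real (Metric.closedBall x r) ≤ r ^ s)
    (hup : ∀ s > d, ∀ᵐ x ∂ν, ∀ᶠ r in 𝓝[>] (0 : ℝ), r ^ s ≤ ν.real (Metric.closedBall x r)) :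
    IsExactOfDimension ν d := by
  have h1 : ∀ᵐ x ∂ν, ∀ n : ℕ, ∀ᶠ r in 𝓝[>] (0 : ℝ),
      ν.real (Metric.closedBall x r) ≤ r ^ (d - 1 / ((n : ℝ) + 1)) :=
    ae_all_iff.2 fun n => hlow _ (sub_lt_self _ (by positivity))
  have h2 : ∀ᵐ x ∂ν, ∀ n : ℕ, ∀ᶠ r in 𝓝[>] (0 : ℝ),
      r ^ (d + 1 / ((n : ℝ) + 1)) ≤ ν.real (Metric.closedBall x r) :=
    ae_all_iff.2 fun n => hup _ (lt_add_of_pos_right _ (by positivity))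
  unfold IsExactOfDimension
  filter_upwards [h1, h2] with x hx1 hx2
  have hsmall : ∀ᶠ r in 𝓝[>] (0 : ℝ), 0 < r ∧ Real.log r < 0 := by
    filter_upwards [Ioo_mem_nhdsGT (zero_lt_one' ℝ)] with r hr
    exact ⟨hr.1, Real.log_neg hr.1 hr.2⟩
  refine tendsto_order.2 ⟨fun l hl => ?_, fun l hl => ?_⟩
  · obtain ⟨n, hn⟩ := exists_nat_one_div_lt (sub_pos.2 hl)
    -- The lower power bound `hx2 0` serves only to make the ball's measure positive, so that its
    -- logarithm is genuine.
    filter_upwards [hx1 n, hx2 0, hsmall] with r hr1 hr2 ⟨hr0, hlr⟩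
    have hpos : 0 < ν.real (Metric.closedBall x r) := (Real.rpow_pos_of_pos hr0 _).trans_le hr2
    have h3 := Real.log_le_log hpos hr1
    rw [Real.log_rpow hr0] at h3
    have h4 := (le_div_iff_of_neg hlr).2 h3
    linarith
  · obtain ⟨n, hn⟩ := exists_nat_one_div_lt (sub_pos.2 hl)
    filter_upwards [hx2 n, hsmall] with r hr2 ⟨hr0, hlr⟩
    have h3 := Real.log_le_log (Real.rpow_pos_of_pos hr0 _) hr2
    rw [Real.log_rpow hr0] at h3
    have h4 := (div_le_iff_of_neg hlr).2 h3
    linarith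

theorem measurableSet_meshCube (r : ℝ) (j : Fin N → ℤ) :
    MeasurableSet (meshCube r j : Set (EuclideanSpace ℝ (Fin N))) := by
  have : (meshCube r j : Set (EuclideanSpace ℝ (Fin N))) =
      ⋂ l, (fun x : EuclideanSpace ℝ (Fin N) => x l) ⁻¹'
        Set.Ico ((j l : ℝ) * r) (((j l : ℝ) + 1) * r) := by
    ext x
    simp [meshCube]
  rw [this]
  exact .iInter fun l =>
    (by fun_prop : Measurable fun x : EuclideanSpace ℝ (Fin N) => x l) measurableSet_Ico

theorem mem_meshCube_iff {r : ℝ} (hr : 0 < r) (j : Fin N → ℤ) (x : EuclideanSpace ℝ (Fin N)) :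
    x ∈ meshCube r j ↔ ∀ l, ⌊x l / r⌋ = j l := by
  refine forall_congr' fun l => ?_
  rw [Int.floor_eq_iff, le_div_iff₀ hr, div_lt_iff₀ hr, Set.mem_Ico]

theorem pairwise_disjoint_meshCube {r : ℝ} (hr : 0 < r) :
    Pairwise (Function.onFun Disjoint fun j : Fin N → ℤ =>
      (meshCube r j : Set (EuclideanSpace ℝ (Fin N)))) := by
  intro i j hij
  refine Set.disjoint_left.2 fun x hi hj => hij ?_
  rw [mem_meshCube_iff hr] at hi hj
  funext l
  rw [← hi l, hj l]

theorem iUnion_meshCube {r : ℝ} (hr : 0 < r) :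
    ⋃ j : Fin N → ℤ, (meshCube r j : Set (EuclideanSpace ℝ (Fin N))) = Set.univ :=
  Set.eq_univ_of_forall fun x =>
    Set.mem_iUnion.2 ⟨fun l => ⌊x l / r⌋, (mem_meshCube_iff hr _ x).2 fun _ => rfl⟩

theorem tsum_measure_meshCube_inter {r : ℝ} (hr : 0 < r) {A : Set (EuclideanSpace ℝ (Fin N))}
    (hA : MeasurableSet A) :
    ∑' j : Fin N → ℤ, ν (meshCube r j ∩ A) = ν A := by
  rw [← measure_iUnion (fun i j hij => (pairwise_disjoint_meshCube hr hij).mono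
    Set.inter_subset_left Set.inter_subset_left)
    fun j => (measurableSet_meshCube r j).inter hA, ← Set.iUnion_inter, iUnion_meshCube hr,
    Set.univ_inter]

variable [IsProbabilityMeasure ν]

theorem measurable_measureReal_closedBall (r : ℝ) :
    Measurable fun x => ν.real (Metric.closedBall x r) := by
  have : MeasurableSet {q : EuclideanSpace ℝ (Fin N) × EuclideanSpace ℝ (Fin N) |
      dist q.2 q.1 ≤ r} :=
    measurableSet_le (measurable_snd.dist measurable_fst) measurable_const
  exact (measurable_measure_prodMk_left (ν := ν) this).ennreal_toReal

/-- Replaces pointwise thresholds by a set of nearly full measure at each single scale, the form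
that entropy estimates need. -/
theorem tendsto_measureReal_of_ae_eventually {A : ℝ → Set (EuclideanSpace ℝ (Fin N))}
    (hA : ∀ r, MeasurableSet (A r))
    (h : ∀ᵐ x ∂ν, ∀ᶠ r in 𝓝[>] (0 : ℝ), x ∈ A r) :
    Tendsto (fun r => ν.real (A r)) (𝓝[>] 0) (𝓝 1) := by
  have h1 := tendsto_measure_of_ae_tendsto_indicator_of_isFiniteMeasure (μ := ν) (𝓝[>] (0 : ℝ))
    MeasurableSet.univ hA (by
      filter_upwards [h] with x hx
      filter_upwards [hx] with r hr
      simp [hr])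
  have h2 := (ENNReal.tendsto_toReal (measure_ne_top ν _)).comp h1
  simpa [Measure.real, Function.comp_def] using h2

theorem meshCube_subset_closedBall {r : ℝ} (hr : 0 < r) {j : Fin N → ℤ}
    {x : EuclideanSpace ℝ (Fin N)}
    (hx : x ∈ meshCube r j) : meshCube r j ⊆ Metric.closedBall x (√N * r) := by
  intro y hy
  rw [Metric.mem_closedBall, dist_eq_norm]
  refine norm_le_of_abs_inner_le (EuclideanSpace.basisFun (Fin N) ℝ) hr.le fun l => ?_
  have h1 := hx l
  have h2 := hy l
  rw [real_inner_comm, EuclideanSpace.basisFun_inner, PiLp.sub_apply, abs_le]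
  rw [Set.mem_Ico] at h1 h2
  constructor <;> linarith

/-- A cube of side r meeting the set lies in a ρ-ball centred at a point of it. So its mass is at
most ρ^s, and its entropy term is at least its mass times s·(-log ρ). -/
theorem measure_mul_le_meshEntropy {r ρ s : ℝ} (hr : 0 < r) (hρ : √N * r ≤ ρ) (hρ0 : 0 < ρ) :
    ENNReal.ofReal (ν.real {x | ν.real (Metric.closedBall x ρ) ≤ ρ ^ s} * (s * -Real.log ρ)) ≤
      meshEntropy ν r := by
  set A : Set (EuclideanSpace ℝ (Fin N)) := {x | ν.real (Metric.closedBall x ρ) ≤ ρ ^ s}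
  have hA : MeasurableSet A := measurableSet_le (measurable_measureReal_closedBall ρ)
    measurable_const
  rw [ENNReal.ofReal_mul measureReal_nonneg, ofReal_measureReal,
    ← tsum_measure_meshCube_inter hr hA, ← ENNReal.tsum_mul_right]
  refine ENNReal.tsum_le_tsum fun j => ?_
  rcases Set.eq_empty_or_nonempty (meshCube r j ∩ A) with he | ⟨x, hxj, hxA⟩
  · simp [he]
  have hle : ν.real (meshCube r j) ≤ ρ ^ s :=
    (measureReal_mono ((meshCube_subset_closedBall hr hxj).trans
      (Metric.closedBall_subset_closedBall hρ))).trans hxA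
  rcases (measureReal_nonneg (μ := ν) (s := meshCube r j)).eq_or_lt with h0 | h0
  · have : ν (meshCube r j ∩ A) = 0 :=
      measure_mono_null Set.inter_subset_left ((measureReal_eq_zero_iff).1 h0.symm)
    simp [this]
  calc ν (meshCube r j ∩ A) * ENNReal.ofReal (s * -Real.log ρ)
      ≤ ν (meshCube r j) * ENNReal.ofReal (s * -Real.log ρ) := by
        gcongr
        exact Set.inter_subset_left
    _ = ENNReal.ofReal (ν.real (meshCube r j) * (s * -Real.log ρ)) := by
        rw [ENNReal.ofReal_mul h0.le, ofReal_measureReal]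
    _ ≤ _ := by
        refine ENNReal.ofReal_le_ofReal ?_
        rw [← mul_neg]
        have := Real.log_le_log h0 hle
        rw [Real.log_rpow hρ0] at this
        gcongr
        linarith

/-- The preceding estimate is used with ρ = √N·r, the diameter of a cube; the factor √N disappears
in the quotient of logarithms. -/
theorem le_lowerInfoDim (hN : 1 ≤ N) {s t : ℝ} (hts : t < s)
    (hlow : ∀ᵐ x ∂ν, ∀ᶠ r in 𝓝[>] (0 : ℝ), ν.real (Metric.closedBall x r) ≤ r ^ s) :
    ENNReal.ofReal t ≤ lowerInfoDim ν := by
  let K : ℝ := √N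
  have hK : 0 < K := Real.sqrt_pos.2 (by exact_mod_cast hN)
  have hscale : Tendsto (fun r : ℝ => K * r) (𝓝[>] 0) (𝓝[>] 0) := by
    refine tendsto_nhdsWithin_iff.2 ⟨?_, ?_⟩
    · have : Tendsto (fun r : ℝ => K * r) (𝓝 0) (𝓝 (K * 0)) := tendsto_id.const_mul K
      rw [mul_zero] at this
      exact this.mono_left nhdsWithin_le_nhds
    · filter_upwards [self_mem_nhdsWithin] with r hr using mul_pos hK hr
  have hA : Tendsto (fun r => ν.real {x | ν.real (Metric.closedBall x r) ≤ r ^ s}) (𝓝[>] 0)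
      (𝓝 1) := tendsto_measureReal_of_ae_eventually
    (fun r => measurableSet_le (measurable_measureReal_closedBall r) measurable_const) hlow
  have hlog : Tendsto (fun r : ℝ => -Real.log r) (𝓝[>] 0) atTop :=
    tendsto_neg_atBot_atTop.comp Real.tendsto_log_nhdsGT_zero
  have hratio : Tendsto (fun r : ℝ => ν.real {x | ν.real (Metric.closedBall x (K * r)) ≤
      (K * r) ^ s} * (s * (1 - Real.log K / -Real.log r))) (𝓝[>] 0) (𝓝 (1 * (s * (1 - 0)))) :=
    (hA.comp hscale).mul ((tendsto_const_nhds.sub (tendsto_const_nhds.div_atTop hlog)).const_mul s)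
  rw [sub_zero, mul_one, one_mul] at hratio
  refine le_liminf_of_le (by isBoundedDefault) ?_
  filter_upwards [hratio.eventually (lt_mem_nhds hts), self_mem_nhdsWithin,
    hscale.eventually (Ioo_mem_nhdsGT zero_lt_one), hlog.eventually_gt_atTop 0]
    with r hr hr0 hKr hlr
  have hr0 : 0 < r := hr0
  rw [ENNReal.le_div_iff_mul_le (Or.inl (ENNReal.ofReal_pos.2 hlr).ne')
    (Or.inl ENNReal.ofReal_ne_top), ← ENNReal.ofReal_mul' hlr.le]
  refine (ENNReal.ofReal_le_ofReal ?_).trans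
    (measure_mul_le_meshEntropy (ν := ν) (s := s) hr0 le_rfl hKr.1)
  have h1 : -Real.log (K * r) = (1 - Real.log K / -Real.log r) * -Real.log r := by
    rw [Real.log_mul hK.ne' hr0.ne', sub_mul, div_mul_cancel₀ _ hlr.ne']
    ring
  rw [show √(N : ℝ) = K from rfl, h1, ← mul_assoc, ← mul_assoc]
  rw [← mul_assoc] at hr
  gcongr

/-- The inequality log y ≤ y - 1 at y = 1/(qn) bounds each term by q log n + 1/n, and there are at
most n terms. -/
theorem sum_negMulLog_le {ι : Type*} (G : Finset ι) {q : ι → ℝ} (hq : ∀ j ∈ G, 0 ≤ q j) {n : ℝ}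
    (hn : 0 < n) (hG : (G.card : ℝ) ≤ n) :
    ∑ j ∈ G, -(q j * Real.log (q j)) ≤ (∑ j ∈ G, q j) * Real.log n + 1 := by
  have h1 : ∀ j ∈ G, -(q j * Real.log (q j)) ≤ q j * Real.log n + 1 / n := by
    intro j hj
    rcases (hq j hj).eq_or_lt with h0 | h0
    · rw [← h0]
      simp only [zero_mul, neg_zero, zero_add]
      positivity
    · have h2 := Real.log_le_sub_one_of_pos (show 0 < 1 / (q j * n) by positivity)
      rw [one_div, Real.log_inv, Real.log_mul h0.ne' hn.ne'] at h2
      have h3 := mul_le_mul_of_nonneg_left h2 h0.le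
      have h4 : q j * ((q j * n)⁻¹ - 1) = 1 / n - q j := by field_simp
      rw [h4] at h3
      linarith
  refine (Finset.sum_le_sum h1).trans ?_
  rw [Finset.sum_add_distrib, ← Finset.sum_mul, Finset.sum_const, nsmul_eq_mul, mul_one_div]
  gcongr
  rwa [div_le_one hn]

theorem sum_measureReal_meshCube_le {r : ℝ} (hr : 0 < r) (G : Finset (Fin N → ℤ))
    {S : Set (EuclideanSpace ℝ (Fin N))}
    (hS : ∀ j ∈ G, meshCube r j ⊆ S) : ∑ j ∈ G, ν.real (meshCube r j) ≤ ν.real S := by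
  rw [← measureReal_biUnion_finset (fun i _ j _ hij => pairwise_disjoint_meshCube hr hij)
    fun j _ => measurableSet_meshCube r j]
  exact measureReal_mono (Set.iUnion₂_subset hS)

/-- An r-ball centred in a cube is covered by that cube and its neighbours, 3^N cubes in all. For
each of the 3^N displacements the displaced cubes are disjoint, with total mass at most 1. -/
theorem card_mul_le_of_meets {r v : ℝ} (hr : 0 < r) (G : Finset (Fin N → ℤ))
    (hG : ∀ j ∈ G, ∃ x ∈ (meshCube r j : Set (EuclideanSpace ℝ (Fin N))),
      v ≤ ν.real (Metric.closedBall x r)) :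
    G.card * v ≤ 3 ^ N := by
  let D : Finset (Fin N → ℤ) := Fintype.piFinset fun _ => Finset.Icc (-1 : ℤ) 1
  have hD : D.card = 3 ^ N := by simp [D]
  have h1 : ∀ j ∈ G, v ≤ ∑ e ∈ D, ν.real (meshCube r (j + e)) := by
    intro j hj
    obtain ⟨x, hx, hv⟩ := hG j hj
    have hsub : Metric.closedBall x r ⊆ ⋃ e ∈ D, meshCube r (j + e) := by
      intro y hy
      have hyx : ∀ l, |y l - x l| ≤ r := fun l => by
        have h := PiLp.norm_apply_le (y - x) l
        rw [Metric.mem_closedBall, dist_eq_norm] at hy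
        rw [PiLp.sub_apply, Real.norm_eq_abs] at h
        exact h.trans hy
      refine Set.mem_iUnion₂.2 ⟨fun l => ⌊y l / r⌋ - j l, ?_, ?_⟩
      · simp only [D, Fintype.mem_piFinset, Finset.mem_Icc]
        intro l
        have h2 := hx l
        have h3 := abs_le.1 (hyx l)
        rw [Set.mem_Ico] at h2
        constructor
        · have : j l - 1 ≤ ⌊y l / r⌋ := by
            rw [Int.le_floor, le_div_iff₀ hr]
            push_cast
            linarith
          linarith
        · have : ⌊y l / r⌋ < j l + 2 := by
            rw [Int.floor_lt, div_lt_iff₀ hr]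
            push_cast
            linarith
          linarith
      · rw [mem_meshCube_iff hr]
        intro l
        simp
    refine hv.trans ((measureReal_mono hsub (measure_ne_top ν _)).trans ?_)
    exact measureReal_biUnion_finset_le _ _
  have h2 : ∑ j ∈ G, ∑ e ∈ D, ν.real (meshCube r (j + e)) ≤ 3 ^ N := by
    rw [Finset.sum_comm]
    calc _ ≤ ∑ _e ∈ D, (1 : ℝ) := Finset.sum_le_sum fun e _ => by
          have h3 := sum_measureReal_meshCube_le (ν := ν) hr (G.map (addRightEmbedding e))
            (S := Set.univ) fun _ _ => Set.subset_univ _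
          rw [Finset.sum_map, probReal_univ] at h3
          exact h3
      _ = 3 ^ N := by simp [hD]
  calc (G.card : ℝ) * v = ∑ _j ∈ G, v := by simp
    _ ≤ _ := Finset.sum_le_sum h1
    _ ≤ _ := h2

/-- The mesh entropy of a measure on a bounded set, in terms of the set where balls have large
measure. -/
theorem meshEntropy_le {R r s : ℝ} (hR : 0 ≤ R) (hν : ν (Metric.closedBall 0 R)ᶜ = 0) (hr : 0 < r)
    (hr1 : r < 1) (hs : 0 ≤ s) :
    meshEntropy ν r ≤ ENNReal.ofReal (N * Real.log 3 + s * -Real.log r + 1 +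
      ((1 - ν.real {x | r ^ s ≤ ν.real (Metric.closedBall x r)}) *
        (N * (Real.log (2 * R + 5) + -Real.log r)) + 1)) := by
  classical
  set A : Set (EuclideanSpace ℝ (Fin N)) := {x | r ^ s ≤ ν.real (Metric.closedBall x r)}
  have hA : MeasurableSet A := measurableSet_le measurable_const
    (measurable_measureReal_closedBall r)
  -- Cubes with all indices in [-M, M] cover the ball of radius R. As Mr ≤ R + 2r and r < 1, (2M +
  -- 1)r ≤ 2R + 5.
  let M : ℕ := ⌈R / r⌉₊ + 1
  let J : Finset (Fin N → ℤ) := Fintype.piFinset fun _ => Finset.Icc (-(M : ℤ)) M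
  have hJ0 : ∀ j ∉ J, ν.real (meshCube r j) = 0 := by
    intro j hj
    rw [measureReal_eq_zero_iff]
    refine measure_mono_null (fun x hx => ?_) hν
    contrapose! hj
    rw [Set.notMem_compl_iff, mem_closedBall_zero_iff] at hj
    simp only [J, Fintype.mem_piFinset, Finset.mem_Icc]
    intro l
    have h1 : |x l| ≤ R := (PiLp.norm_apply_le x l).trans hj
    have h2 := abs_le.1 h1
    rw [mem_meshCube_iff hr] at hx
    rw [← hx l]
    have h3 : R / r ≤ ⌈R / r⌉₊ := Nat.le_ceil _
    have h4 := (div_le_iff₀ hr).1 h3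
    constructor
    · rw [Int.le_floor, le_div_iff₀ hr]
      simp only [M]
      push_cast
      linarith
    · have : ⌊x l / r⌋ < (M : ℤ) := by
        rw [Int.floor_lt, div_lt_iff₀ hr]
        simp only [M]
        push_cast
        linarith
      exact this.le
  have hJcard : (J.card : ℝ) ≤ ((2 * R + 5) / r) ^ N := by
    have h1 : J.card = (2 * M + 1) ^ N := by
      simp only [J, Fintype.card_piFinset_const, Int.card_Icc]
      congr 1
      omega
    rw [h1]
    push_cast
    gcongr
    rw [le_div_iff₀ hr]
    have h2 := (Nat.ceil_lt_add_one (div_nonneg hR hr.le)).le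
    have h3 : (M : ℝ) * r ≤ R + 2 * r := by
      have h4 : (M : ℝ) ≤ R / r + 2 := by
        simp only [M]
        push_cast
        linarith
      calc (M : ℝ) * r ≤ (R / r + 2) * r := by gcongr
        _ = R + 2 * r := by rw [add_mul, div_mul_cancel₀ _ hr.ne']
    linarith
  have hnn : ∀ j : Fin N → ℤ, 0 ≤ -(ν.real (meshCube r j) * Real.log (ν.real (meshCube r j))) :=
    fun j => by
      rw [← mul_neg]
      exact mul_nonneg measureReal_nonneg
        (neg_nonneg.2 (Real.log_nonpos measureReal_nonneg measureReal_le_one))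
  rw [meshEntropy, tsum_eq_sum (s := J) fun j hj => by rw [hJ0 j hj]; simp,
    ← ENNReal.ofReal_sum_of_nonneg fun j _ => hnn j]
  refine ENNReal.ofReal_le_ofReal ?_
  -- At most 3^N r^{-s} cubes meet A, giving the main term s·(-log r). The others are still
  -- polynomially many in 1/r, but carry only the mass outside A.
  rw [← Finset.sum_filter_add_sum_filter_not J fun j => (meshCube r j ∩ A).Nonempty]
  have hrs : 0 < r ^ s := Real.rpow_pos_of_pos hr s
  have hrs1 : r ^ s ≤ 1 := Real.rpow_le_one hr.le hr1.le hs
  have hlr : 0 ≤ -Real.log r := neg_nonneg.2 (Real.log_nonpos hr.le hr1.le)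
  refine add_le_add ?_ ?_
  · have h1 := card_mul_le_of_meets (ν := ν) hr (J.filter fun j => (meshCube r j ∩ A).Nonempty)
      (v := r ^ s) fun j hj => by
        obtain ⟨x, hx, hxA⟩ := (Finset.mem_filter.1 hj).2
        exact ⟨x, hx, hxA⟩
    have h2 := sum_negMulLog_le (J.filter fun j => (meshCube r j ∩ A).Nonempty)
      (q := fun j => ν.real (meshCube r j)) (fun _ _ => measureReal_nonneg)
      (n := 3 ^ N / r ^ s) (by positivity) (by rwa [le_div_iff₀ hrs])
    have h3 : Real.log (3 ^ N / r ^ s) = N * Real.log 3 + s * -Real.log r := by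
      rw [Real.log_div (by positivity) hrs.ne', Real.log_pow, Real.log_rpow hr]
      ring
    have h4 := sum_measureReal_meshCube_le (ν := ν) hr
      (J.filter fun j => (meshCube r j ∩ A).Nonempty) (S := Set.univ) fun _ _ => Set.subset_univ _
    rw [probReal_univ] at h4
    rw [h3] at h2
    have h5 : 0 ≤ N * Real.log 3 + s * -Real.log r := by
      have := Real.log_nonneg (show (1 : ℝ) ≤ 3 by norm_num)
      positivity
    have h6 := mul_le_mul_of_nonneg_right h4 h5
    linarith
  · have hc : 0 < (2 * R + 5) / r := by positivity
    have h2 := sum_negMulLog_le (J.filter fun j => ¬(meshCube r j ∩ A).Nonempty)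
      (q := fun j => ν.real (meshCube r j)) (fun _ _ => measureReal_nonneg)
      (n := ((2 * R + 5) / r) ^ N) (by positivity)
      ((Nat.cast_le.2 (Finset.card_filter_le _ _)).trans hJcard)
    have h3 : Real.log (((2 * R + 5) / r) ^ N) = N * (Real.log (2 * R + 5) + -Real.log r) := by
      rw [Real.log_pow, Real.log_div (by positivity) hr.ne']
      ring
    have h4 := sum_measureReal_meshCube_le (ν := ν) hr
      (J.filter fun j => ¬(meshCube r j ∩ A).Nonempty) (S := Aᶜ) fun j hj x hx hxA =>
        (Finset.mem_filter.1 hj).2 ⟨x, hx, hxA⟩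
    rw [probReal_compl_eq_one_sub hA] at h4
    rw [h3] at h2
    have h5 : 0 ≤ N * (Real.log (2 * R + 5) + -Real.log r) := by
      have := Real.log_nonneg (show (1 : ℝ) ≤ 2 * R + 5 by linarith)
      positivity
    have h6 := mul_le_mul_of_nonneg_right h4 h5
    linarith

/-- After division by -log r, the exceptional cubes contribute a bounded factor times a mass that
tends to 0. -/
theorem upperInfoDim_le {R s t : ℝ} (hR : 0 ≤ R) (hν : ν (Metric.closedBall 0 R)ᶜ = 0)
    (hs : 0 ≤ s) (hst : s < t)
    (hup : ∀ᵐ x ∂ν, ∀ᶠ r in 𝓝[>] (0 : ℝ), r ^ s ≤ ν.real (Metric.closedBall x r)) :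
    upperInfoDim ν ≤ ENNReal.ofReal t := by
  have hA : Tendsto (fun r => ν.real {x | r ^ s ≤ ν.real (Metric.closedBall x r)}) (𝓝[>] 0)
      (𝓝 1) := tendsto_measureReal_of_ae_eventually
    (fun r => measurableSet_le measurable_const (measurable_measureReal_closedBall r)) hup
  have hlog : Tendsto (fun r : ℝ => -Real.log r) (𝓝[>] 0) atTop :=
    tendsto_neg_atBot_atTop.comp Real.tendsto_log_nhdsGT_zero
  have hratio : Tendsto (fun r : ℝ => (N * Real.log 3 + 2) / -Real.log r + s +
      (1 - ν.real {x | r ^ s ≤ ν.real (Metric.closedBall x r)}) *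
        (N * (Real.log (2 * R + 5) / -Real.log r + 1))) (𝓝[>] 0)
      (𝓝 (0 + s + (1 - 1) * (N * (0 + 1)))) :=
    ((tendsto_const_nhds.div_atTop hlog).add_const s).add ((hA.const_sub 1).mul
      (((tendsto_const_nhds.div_atTop hlog).add_const 1).const_mul _))
  rw [sub_self, zero_mul, add_zero, zero_add] at hratio
  refine limsup_le_of_le (by isBoundedDefault) ?_
  filter_upwards [hratio.eventually (gt_mem_nhds hst), Ioo_mem_nhdsGT (zero_lt_one' ℝ),
    hlog.eventually_gt_atTop 0] with r hr hr0 hlr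
  rw [ENNReal.div_le_iff (ENNReal.ofReal_pos.2 hlr).ne' ENNReal.ofReal_ne_top,
    ← ENNReal.ofReal_mul' hlr.le]
  refine (meshEntropy_le hR hν hr0.1 hr0.2 hs).trans (ENNReal.ofReal_le_ofReal ?_)
  have h1 := mul_le_mul_of_nonneg_right hr.le hlr.le
  refine le_trans (le_of_eq ?_) h1
  have := hlr.ne'
  generalize -Real.log r = l at this
  field_simp
  ring

theorem hasInfoDim_of_bounds (hN : 1 ≤ N) {R : ℝ} (hR : 0 ≤ R)
    (hν : ν (Metric.closedBall 0 R)ᶜ = 0) (hd : 0 ≤ d)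
    (hlow : ∀ s < d, ∀ᵐ x ∂ν, ∀ᶠ r in 𝓝[>] (0 : ℝ), ν.real (Metric.closedBall x r) ≤ r ^ s)
    (hup : ∀ s > d, ∀ᵐ x ∂ν, ∀ᶠ r in 𝓝[>] (0 : ℝ), r ^ s ≤ ν.real (Metric.closedBall x r)) :
    HasInfoDim ν d := by
  have h1 : ENNReal.ofReal d ≤ lowerInfoDim ν := by
    refine le_of_tendsto (x := 𝓝[<] d)
      ((ENNReal.continuous_ofReal.tendsto d).mono_left nhdsWithin_le_nhds) ?_
    filter_upwards [self_mem_nhdsWithin] with t ht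
    obtain ⟨s, hs1, hs2⟩ := exists_between (show t < d from ht)
    exact le_lowerInfoDim hN hs1 (hlow s hs2)
  have h2 : upperInfoDim ν ≤ ENNReal.ofReal d := by
    refine ge_of_tendsto (x := 𝓝[>] d)
      ((ENNReal.continuous_ofReal.tendsto d).mono_left nhdsWithin_le_nhds) ?_
    filter_upwards [self_mem_nhdsWithin] with t ht
    obtain ⟨s, hs1, hs2⟩ := exists_between (show d < t from ht)
    exact upperInfoDim_le hR hν (hd.trans hs1.le) hs2 (hup s hs1)
  have h3 : lowerInfoDim ν ≤ upperInfoDim ν := liminf_le_limsup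
  exact ⟨le_antisymm (h3.trans h2) h1, le_antisymm h2 (h1.trans h3)⟩

end LocalDimension

end AlmostSelfAffine

namespace AlmostSelfAffine

/-! ### The projection from code space to ℝ^N -/

section Projection

variable {m N : ℕ} {T : Fin m → EuclideanSpace ℝ (Fin N) →L[ℝ] EuclideanSpace ℝ (Fin N)}
  {w : List (Fin m) → EuclideanSpace ℝ (Fin N)} {a R : ℝ}

theorem norm_point_term_le (ha0 : 0 ≤ a) (ha : ∀ c, ‖T c‖ ≤ a)
    (hR : ∀ u c, ‖w (u ++ [c])‖ ≤ R) (v : List (Fin m)) (i : ℕ → Fin m) (k : ℕ) :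
    ‖wordMap T v (w (curtail i (k + 1)))‖ ≤ a ^ v.length * R := by
  refine (norm_wordMap_apply_le ha0 ha v _).trans ?_
  rw [curtail_succ]
  gcongr
  exact hR _ _

theorem summable_point (ha0 : 0 ≤ a) (ha1 : a < 1) (ha : ∀ c, ‖T c‖ ≤ a)
    (hR : ∀ u c, ‖w (u ++ [c])‖ ≤ R) (i : ℕ → Fin m) :
    Summable fun k => wordMap T (curtail i k) (w (curtail i (k + 1))) := by
  refine Summable.of_norm_bounded (g := fun k => a ^ k * R)
    ((summable_geometric_of_lt_one ha0 ha1).mul_right R) fun k => ?_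
  have := norm_point_term_le ha0 ha hR (curtail i k) i k
  rwa [curtail_length] at this

theorem curtail_take (i : ℕ → Fin m) {j k : ℕ} (h : j ≤ k) :
    (curtail i k).take j = curtail i j := by
  obtain ⟨l, rfl⟩ := Nat.exists_eq_add_of_le h
  rw [curtail_add, List.take_left' (curtail_length i j)]

variable (T w) in
/-- The part of `point T w i` that depends only on the initial word of `i`. -/
noncomputable def prefixPoint (u : List (Fin m)) : EuclideanSpace ℝ (Fin N) :=
  ∑ j ∈ Finset.range u.length, wordMap T (u.take j) (w (u.take (j + 1)))

/-- From the k-th term on, the series has T_{i|k} as a common factor. Hence the image of a cylinder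
C_u lies in a translate of T_u(ball), with a radius independent of u. -/
theorem exists_point_eq (ha0 : 0 ≤ a) (ha1 : a < 1) (ha : ∀ c, ‖T c‖ ≤ a)
    (hR : ∀ u c, ‖w (u ++ [c])‖ ≤ R) (i : ℕ → Fin m) (k : ℕ) :
    ∃ y, ‖y‖ ≤ (1 - a)⁻¹ * R ∧
      point T w i = prefixPoint T w (curtail i k) + wordMap T (curtail i k) y := by
  have hb : ∀ j, ‖wordMap T (curtail (seqShift^[k] i) j) (w (curtail i (j + k + 1)))‖ ≤
      a ^ j * R := fun j => by
    have := norm_point_term_le ha0 ha hR (curtail (seqShift^[k] i) j) i (j + k)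
    rwa [curtail_length] at this
  have hg : HasSum (fun j => a ^ j * R) ((1 - a)⁻¹ * R) :=
    (hasSum_geometric_of_lt_one ha0 ha1).mul_right R
  have hsum : Summable fun j =>
      wordMap T (curtail (seqShift^[k] i) j) (w (curtail i (j + k + 1))) :=
    Summable.of_norm_bounded hg.summable hb
  refine ⟨∑' j, wordMap T (curtail (seqShift^[k] i) j) (w (curtail i (j + k + 1))),
    tsum_of_norm_bounded hg hb, ?_⟩
  rw [point, ← (summable_point ha0 ha1 ha hR i).sum_add_tsum_nat_add k,
    ContinuousLinearMap.map_tsum _ hsum]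
  congr 1
  · rw [prefixPoint, curtail_length]
    refine Finset.sum_congr rfl fun j hj => ?_
    have := Finset.mem_range.1 hj
    rw [curtail_take i this.le, curtail_take i this]
  · refine tsum_congr fun j => ?_
    rw [add_comm j k, curtail_add i k j, wordMap_append]
    rfl

theorem norm_point_le (ha0 : 0 ≤ a) (ha1 : a < 1) (ha : ∀ c, ‖T c‖ ≤ a)
    (hR : ∀ u c, ‖w (u ++ [c])‖ ≤ R) (i : ℕ → Fin m) : ‖point T w i‖ ≤ (1 - a)⁻¹ * R := by
  obtain ⟨y, hy, h⟩ := exists_point_eq ha0 ha1 ha hR i 0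
  rw [h]
  simpa [prefixPoint, curtail, wordMap_nil] using hy

/-- Joint measurability in the outcome and the word is what Tonelli's theorem requires. Each term
depends on finitely many letters, so it is checked word by word. -/
theorem measurable_point_prod {Ω : Type*} [MeasurableSpace Ω]
    {w : Ω → List (Fin m) → EuclideanSpace ℝ (Fin N)} (hw : ∀ u, Measurable fun ω => w ω u)
    (ha0 : 0 ≤ a) (ha1 : a < 1) (ha : ∀ c, ‖T c‖ ≤ a) (hR : ∀ ω u c, ‖w ω (u ++ [c])‖ ≤ R) :
    Measurable fun q : Ω × (ℕ → Fin m) => point T (w q.1) q.2 := by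
  have hterm : ∀ k, Measurable fun q : Ω × (ℕ → Fin m) =>
      wordMap T (curtail q.2 k) (w q.1 (curtail q.2 (k + 1))) := by
    intro k
    have h1 : Measurable fun q : Ω × (Fin (k + 1) → Fin m) =>
        wordMap T ((List.ofFn q.2).take k) (w q.1 (List.ofFn q.2)) :=
      measurable_from_prod_countable_left fun u =>
        (wordMap T ((List.ofFn u).take k)).continuous.measurable.comp (hw (List.ofFn u))
    have h2 : Measurable fun q : Ω × (ℕ → Fin m) => (q.1, fun j : Fin (k + 1) => q.2 j) :=
      measurable_fst.prodMk ((measurable_curtail (k + 1)).comp measurable_snd)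
    have h3 : (fun q : Ω × (ℕ → Fin m) =>
        wordMap T (curtail q.2 k) (w q.1 (curtail q.2 (k + 1)))) =
        fun q => wordMap T ((curtail q.2 (k + 1)).take k) (w q.1 (curtail q.2 (k + 1))) := by
      funext q
      rw [curtail_take q.2 (Nat.le_succ k)]
    rw [h3]
    exact h1.comp h2
  refine measurable_of_tendsto_metrizable (f := fun n (q : Ω × (ℕ → Fin m)) =>
    ∑ k ∈ Finset.range n, wordMap T (curtail q.2 k) (w q.1 (curtail q.2 (k + 1))))
    (fun n => Finset.measurable_sum _ fun k _ => hterm k) ?_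
  rw [tendsto_pi_nhds]
  intro q
  exact (summable_point ha0 ha1 ha (hR q.1) q.2).hasSum.tendsto_sum_nat

theorem measurable_point (ha0 : 0 ≤ a) (ha1 : a < 1) (ha : ∀ c, ‖T c‖ ≤ a)
    (hR : ∀ u c, ‖w (u ++ [c])‖ ≤ R) : Measurable (point T w) :=
  (measurable_point_prod (Ω := Unit) (w := fun _ => w) (fun _ => measurable_const) ha0 ha1 ha
    fun _ => hR).comp (measurable_const.prodMk measurable_id : Measurable fun i => ((), i))

end Projection

/-! ### Borel–Cantelli for cells, change of scale, and the general bound N -/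

section Scales

/-- A Borel–Cantelli estimate: cells of too small a measure are met only finitely often. -/
theorem ae_eventually_le_measureReal_fiber {X κ : Type*} [MeasurableSpace X] {μ : Measure X}
    [IsFiniteMeasure μ] (f : ℕ → X → κ) (G : ℕ → Finset κ) (hf : ∀ k x, f k x ∈ G k)
    (q : ℕ → κ → ℝ) (hq0 : ∀ k c, 0 ≤ q k c) (hq : Summable fun k => ∑ c ∈ G k, q k c) :
    ∀ᵐ x ∂μ, ∀ᶠ k in atTop, q k (f k x) ≤ μ.real {y | f k y = f k x} := by
  classical
  let bad (k : ℕ) : Set X := {x | μ.real {y | f k y = f k x} < q k (f k x)}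
  have hbad : ∀ k, μ (bad k) ≤ ENNReal.ofReal (∑ c ∈ G k, q k c) := by
    intro k
    have hsub : bad k ⊆ ⋃ c ∈ (G k).filter fun c => μ.real {y | f k y = c} < q k c,
        {y | f k y = c} := fun x hx =>
      Set.mem_iUnion₂.2 ⟨f k x, Finset.mem_filter.2 ⟨hf k x, hx⟩, rfl⟩
    calc μ (bad k) ≤ ∑ c ∈ (G k).filter fun c => μ.real {y | f k y = c} < q k c,
          μ {y | f k y = c} := (measure_mono hsub).trans (measure_biUnion_finset_le _ _)
      _ ≤ ∑ c ∈ (G k).filter fun c => μ.real {y | f k y = c} < q k c, ENNReal.ofReal (q k c) := by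
        refine Finset.sum_le_sum fun c hc => ?_
        rw [← ofReal_measureReal]
        exact ENNReal.ofReal_le_ofReal (Finset.mem_filter.1 hc).2.le
      _ ≤ ∑ c ∈ G k, ENNReal.ofReal (q k c) :=
        Finset.sum_le_sum_of_subset (Finset.filter_subset _ _)
      _ = _ := (ENNReal.ofReal_sum_of_nonneg fun c _ => hq0 k c).symm
  have hsum : ∑' k, μ (bad k) ≠ ∞ :=
    ne_top_of_le_ne_top hq.tsum_ofReal_ne_top (ENNReal.tsum_le_tsum hbad)
  filter_upwards [ae_eventually_notMem hsum] with x hx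
  filter_upwards [hx] with k hk using not_lt.1 hk

/-- Power bounds along a sequence of scales of bounded ratio extend to all small scales. -/
theorem eventually_rpow_le_of_scales {F : ℝ → ℝ} (hF : Monotone F) {ρ : ℕ → ℝ} (hρ0 : ∀ k, 0 < ρ k)
    (hρ : Tendsto ρ atTop (𝓝 0)) {b s : ℝ} (hb : 0 < b) (hbρ : ∀ k, b * ρ k ≤ ρ (k + 1))
    (hs : 0 ≤ s) (h : ∀ᶠ k in atTop, b⁻¹ ^ s * ρ k ^ s ≤ F (ρ k)) :
    ∀ᶠ r in 𝓝[>] (0 : ℝ), r ^ s ≤ F r := by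
  classical
  obtain ⟨k₀, hk₀⟩ := eventually_atTop.1 h
  filter_upwards [Ioo_mem_nhdsGT (hρ0 k₀)] with r hr
  have hex : ∃ k, ρ (k₀ + k) ≤ r := by
    obtain ⟨k, hk⟩ := eventually_atTop.1 (hρ.eventually (gt_mem_nhds hr.1))
    exact ⟨k, (hk _ (Nat.le_add_left _ _)).le⟩
  -- The first scale not exceeding r has a predecessor above r, so it is itself at least b·r.
  obtain ⟨l, hl⟩ : ∃ l, Nat.find hex = l + 1 := Nat.exists_eq_succ_of_ne_zero fun h0 => by
    have := Nat.find_spec hex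
    rw [h0] at this
    exact absurd hr.2 (not_lt.2 this)
  have h1 : ρ (k₀ + (l + 1)) ≤ r := hl ▸ Nat.find_spec hex
  have h2 : r < ρ (k₀ + l) := not_le.1 (Nat.find_min hex (by omega))
  have h3 : b * r ≤ ρ (k₀ + (l + 1)) := (mul_le_mul_of_nonneg_left h2.le hb.le).trans (hbρ _)
  calc r ^ s = b⁻¹ ^ s * (b * r) ^ s := by
        rw [← Real.mul_rpow (by positivity) (mul_nonneg hb.le hr.1.le),
          inv_mul_cancel_left₀ hb.ne']
    _ ≤ b⁻¹ ^ s * ρ (k₀ + (l + 1)) ^ s := by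
        gcongr
        exact mul_nonneg hb.le hr.1.le
    _ ≤ F (ρ (k₀ + (l + 1))) := hk₀ _ (Nat.le_add_right _ _)
    _ ≤ F r := hF h1

theorem monotone_measureReal_closedBall {X : Type*} [PseudoMetricSpace X] [MeasurableSpace X]
    (ν : Measure X) [IsFiniteMeasure ν] (x : X) :
    Monotone fun r => ν.real (Metric.closedBall x r) := fun _ _ h =>
  measureReal_mono (Metric.closedBall_subset_closedBall h)

/-- Lower bounds for the measure of balls pass from a parametrization to the image measure. -/
theorem ae_map_eventually_rpow_le {X : Type*} [MeasurableSpace X] {μ : Measure X}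
    [IsProbabilityMeasure μ] {N : ℕ} {f : X → EuclideanSpace ℝ (Fin N)} (hf : Measurable f)
    {s t : ℝ} (hs : 0 ≤ s) (hst : s < t)
    (h : ∀ᵐ i ∂μ, ∀ᶠ r in 𝓝[>] (0 : ℝ), r ^ s ≤ (μ.map f).real (Metric.closedBall (f i) r)) :
    ∀ᵐ x ∂(μ.map f), ∀ᶠ r in 𝓝[>] (0 : ℝ), r ^ t ≤ (μ.map f).real (Metric.closedBall x r) := by
  have := Measure.isProbabilityMeasure_map (μ := μ) hf.aemeasurable
  -- Restricting to dyadic scales makes the event measurable, as transfer through the image measure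
  -- needs. The return to all radii costs the factor 2^t, absorbed by ρ_k^{t-s} → 0.
  let ρ (k : ℕ) : ℝ := (1 / 2) ^ k
  have hρ0 : ∀ k, 0 < ρ k := fun k => by positivity
  have hρ : Tendsto ρ atTop (𝓝 0) := tendsto_pow_atTop_nhds_zero_of_lt_one (by norm_num)
    (by norm_num)
  have hmeas : MeasurableSet {x : EuclideanSpace ℝ (Fin N) | ∀ᶠ k in atTop,
      (1 / 2 : ℝ)⁻¹ ^ t * ρ k ^ t ≤ (μ.map f).real (Metric.closedBall x (ρ k))} := by
    simp only [eventually_atTop]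
    have : {x : EuclideanSpace ℝ (Fin N) | ∃ n, ∀ k ≥ n,
        (1 / 2 : ℝ)⁻¹ ^ t * ρ k ^ t ≤ (μ.map f).real (Metric.closedBall x (ρ k))} =
        ⋃ n, ⋂ k, ⋂ (_ : k ≥ n), {x | (1 / 2 : ℝ)⁻¹ ^ t * ρ k ^ t ≤
          (μ.map f).real (Metric.closedBall x (ρ k))} := by
      ext x
      simp
    rw [this]
    exact .iUnion fun n => .iInter fun k => .iInter fun _ =>
      measurableSet_le measurable_const (measurable_measureReal_closedBall _)
  have hpow : Tendsto (fun k => ρ k ^ (t - s)) atTop (𝓝 0) := by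
    have := (Real.continuousAt_rpow_const 0 (t - s) (Or.inr (sub_pos.2 hst).le)).tendsto.comp hρ
    rwa [Real.zero_rpow (sub_pos.2 hst).ne'] at this
  have hpos : (0 : ℝ) < ((1 / 2 : ℝ)⁻¹ ^ t)⁻¹ := by positivity
  have hae : ∀ᵐ x ∂(μ.map f), ∀ᶠ k in atTop,
      (1 / 2 : ℝ)⁻¹ ^ t * ρ k ^ t ≤ (μ.map f).real (Metric.closedBall x (ρ k)) := by
    rw [ae_map_iff hf.aemeasurable hmeas]
    filter_upwards [h] with i hi
    have hρ' : Tendsto ρ atTop (𝓝[>] 0) :=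
      tendsto_nhdsWithin_iff.2 ⟨hρ, Eventually.of_forall hρ0⟩
    filter_upwards [hρ'.eventually hi, hpow.eventually (gt_mem_nhds hpos)] with k hk hk2
    refine le_trans ?_ hk
    have h1 : ρ k ^ t = ρ k ^ (t - s) * ρ k ^ s := by
      rw [← Real.rpow_add (hρ0 k)]
      ring_nf
    have h2 : (1 / 2 : ℝ)⁻¹ ^ t * ρ k ^ (t - s) ≤ 1 := by
      rw [← le_inv_mul_iff₀ (by positivity), mul_one]
      exact hk2.le
    rw [h1, ← mul_assoc]
    exact mul_le_of_le_one_left (Real.rpow_nonneg (hρ0 k).le s) h2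
  filter_upwards [hae] with x hx
  exact eventually_rpow_le_of_scales (monotone_measureReal_closedBall _ x) hρ0 hρ
    (by norm_num : (0 : ℝ) < 1 / 2) (fun k => by simp only [ρ, pow_succ]; linarith)
    (hs.trans hst.le) hx

/-- The upper local dimension of a measure on `ℝ^N` is almost everywhere at most `N`. -/
theorem ae_eventually_rpow_le_of_dim_lt {N : ℕ} (ν : Measure (EuclideanSpace ℝ (Fin N)))
    [IsProbabilityMeasure ν] {s : ℝ} (hs : (N : ℝ) < s) :
    ∀ᵐ x ∂ν, ∀ᶠ r in 𝓝[>] (0 : ℝ), r ^ s ≤ ν.real (Metric.closedBall x r) := by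
  -- The density of Lebesgue measure with respect to ν is finite ν-almost everywhere, so at such
  -- points ν of an r-ball is at least a constant times r^N.
  filter_upwards [Besicovitch.ae_tendsto_rnDeriv (volume : Measure (EuclideanSpace ℝ (Fin N))) ν,
    Measure.rnDeriv_lt_top volume ν] with x hx hxt
  obtain ⟨c, hc1, hc2⟩ := ENNReal.lt_iff_exists_nnreal_btwn.1 hxt
  let V : ℝ := volume.real (Metric.ball (0 : EuclideanSpace ℝ (Fin N)) 1)
  have hV : 0 < V := ENNReal.toReal_pos (Metric.measure_ball_pos _ _ one_pos).ne'
    measure_ball_lt_top.ne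
  have hpow : Tendsto (fun r : ℝ => r ^ (s - N)) (𝓝[>] 0) (𝓝 0) := by
    have := (Real.continuousAt_rpow_const 0 (s - N) (Or.inr (sub_pos.2 hs).le)).tendsto
    rw [Real.zero_rpow (sub_pos.2 hs).ne'] at this
    exact this.mono_left nhdsWithin_le_nhds
  have hpos : 0 < V / (c + 1) := by positivity
  filter_upwards [hx.eventually (gt_mem_nhds hc1), hpow.eventually (gt_mem_nhds hpos),
    self_mem_nhdsWithin] with r hr hr2 hr0
  have hr0 : 0 < r := hr0
  have hvol : volume (Metric.closedBall x r) = ENNReal.ofReal (r ^ N * V) := by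
    rw [Measure.addHaar_closedBall _ _ hr0.le, ENNReal.ofReal_mul (by positivity),
      ofReal_measureReal (measure_ball_lt_top.ne)]
    simp
  have h1 : ENNReal.ofReal (r ^ N * V) ≤ c * ν (Metric.closedBall x r) := by
    rw [← hvol]
    exact (ENNReal.div_le_iff_le_mul (Or.inr ENNReal.coe_ne_top)
      (Or.inl (measure_ne_top ν _))).1 hr.le
  have h2 : r ^ N * V ≤ c * ν.real (Metric.closedBall x r) := by
    have := ENNReal.toReal_mono (ENNReal.mul_ne_top ENNReal.coe_ne_top (measure_ne_top ν _)) h1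
    rwa [ENNReal.toReal_ofReal (by positivity), ENNReal.toReal_mul, ENNReal.coe_toReal] at this
  have h3 : r ^ s = r ^ (s - N) * r ^ N := by
    rw [← Real.rpow_natCast r N, ← Real.rpow_add hr0, sub_add_cancel]
  rw [h3]
  have h4 : r ^ (s - N) * r ^ N ≤ V / (c + 1) * r ^ N := by gcongr
  refine h4.trans ?_
  rw [div_mul_eq_mul_div, div_le_iff₀ (by positivity)]
  have := measureReal_nonneg (μ := ν) (s := Metric.closedBall x r)
  linarith

end Scales

end AlmostSelfAffine

namespace AlmostSelfAffine

/-! ### Upper bound for the local dimension when d₁ < N -/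

section UpperBound

variable {m N : ℕ} {T : Fin m → EuclideanSpace ℝ (Fin N) →L[ℝ] EuclideanSpace ℝ (Fin N)}
  {p : Fin m → ℝ} {w : List (Fin m) → EuclideanSpace ℝ (Fin N)} {a R : ℝ}

/-- The product is, up to a constant, the number of cubes of side equal to the singular value of
index ⌊s⌋ that cover the ellipsoid S(ball). -/
theorem svf_eq_prod_div (S : EuclideanSpace ℝ (Fin N) →L[ℝ] EuclideanSpace ℝ (Fin N))
    (hS : Function.Injective S) {s : ℝ} (hs : 0 ≤ s) (hsN : s < N) :
    svf s S = (∏ j ∈ Finset.range ⌊s⌋₊,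
      S.toLinearMap.singularValues j / S.toLinearMap.singularValues ⌊s⌋₊) *
        S.toLinearMap.singularValues ⌊s⌋₊ ^ s := by
  have hn : ⌊s⌋₊ < N := (Nat.floor_lt hs).2 hsN
  have hpos := singularValues_pos_of_injective hS hn
  rw [svf, if_pos hsN.le, Finset.prod_div_distrib, Finset.prod_const, Finset.card_range,
    Real.rpow_sub hpos, Real.rpow_natCast]
  field_simp

/-- The cells, adapted to the singular directions of `S`, that meet an image of a ball under `S`. -/
theorem exists_cells (S : EuclideanSpace ℝ (Fin N) →L[ℝ] EuclideanSpace ℝ (Fin N))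
    (hS : Function.Injective S) {s : ℝ} (hs : 0 ≤ s) (hsN : s < N) {D : ℝ} (hD : 0 ≤ D) :
    ∃ (c : EuclideanSpace ℝ (Fin N) → Fin N → ℤ) (J : Finset (Fin N → ℤ)),
      (∀ y, ‖y‖ ≤ D → c (S y) ∈ J) ∧ J.Nonempty ∧
      (∀ x y, c x = c y → ‖x - y‖ ≤ √N * S.toLinearMap.singularValues ⌊s⌋₊) ∧
      J.card * S.toLinearMap.singularValues ⌊s⌋₊ ^ s ≤ (2 * D + 3) ^ N * svf s S := by
  obtain ⟨f, hf⟩ := S.toLinearMap.exists_orthonormalBasis_abs_inner_le hS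
    (n := N) (by simp)
  have hn : ⌊s⌋₊ < N := (Nat.floor_lt hs).2 hsN
  set α := S.toLinearMap.singularValues
  have hpos : ∀ j < N, 0 < α j := fun j hj => singularValues_pos_of_injective hS hj
  set r := α ⌊s⌋₊
  have hr0 : 0 < r := hpos _ hn
  let M (j : Fin N) : ℕ := ⌈α j * D / r⌉₊
  -- The cells are mesh cubes of side r in the left singular basis, whose axes are those of the
  -- ellipsoid.
  refine ⟨fun x j => ⌊inner ℝ x (f j) / r⌋,
    Fintype.piFinset fun j => Finset.Icc (-(M j : ℤ)) (M j), fun y hy => ?_, ?_, fun x y hxy => ?_,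
    ?_⟩
  · rw [Fintype.mem_piFinset]
    intro j
    rw [Finset.mem_Icc]
    have h1 : |inner ℝ (S y) (f j)| ≤ α j * D :=
      (hf y j).trans (mul_le_mul_of_nonneg_left hy (hpos j j.2).le)
    have h2 : |inner ℝ (S y) (f j) / r| ≤ M j := by
      rw [abs_div, abs_of_pos hr0]
      exact (div_le_div_of_nonneg_right h1 hr0.le).trans (Nat.le_ceil _)
    have h3 := abs_le.1 h2
    constructor
    · rw [Int.le_floor]
      push_cast
      exact h3.1
    · exact_mod_cast (Int.floor_le _).trans h3.2
  · refine ⟨0, Fintype.mem_piFinset.2 fun j => ?_⟩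
    simp
  · refine norm_le_of_abs_inner_le f hr0.le fun l => ?_
    have h1 := (Int.abs_sub_lt_one_of_floor_eq_floor (congrFun hxy l)).le
    rw [inner_sub_left]
    rwa [← sub_div, abs_div, abs_of_pos hr0, div_le_one hr0] at h1
  · rw [svf_eq_prod_div S hS hs hsN, ← mul_assoc]
    gcongr
    rw [Fintype.card_piFinset]
    push_cast
    -- The count is 2M_j + 1 ≤ 2Dα_j/r + 3. This is at most (2D + 3)α_j/r on the long axes, where
    -- α_j ≥ r, and at most 2D + 3 on the others.
    have h1 : ∀ j : Fin N, ((Finset.Icc (-(M j : ℤ)) (M j)).card : ℝ) ≤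
        (2 * D + 3) * (if (j : ℕ) < ⌊s⌋₊ then α j / r else 1) := by
      intro j
      have h2 : ((Finset.Icc (-(M j : ℤ)) (M j)).card : ℝ) = 2 * M j + 1 := by
        rw [Int.card_Icc]
        have : ((M j : ℤ) + 1 - -(M j : ℤ)).toNat = 2 * M j + 1 := by omega
        rw [this]
        push_cast
        ring
      have h3 : (M j : ℝ) ≤ α j * D / r + 1 :=
        (Nat.ceil_lt_add_one (div_nonneg (mul_nonneg (hpos j j.2).le hD) hr0.le)).le
      have h4 : α j * D / r = α j / r * D := by ring
      rw [h2]
      split_ifs with h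
      · have h5 : 1 ≤ α j / r := by
          rw [one_le_div hr0]
          exact S.toLinearMap.singularValues_antitone h.le
        nlinarith
      · have h5 : α j / r ≤ 1 := by
          rw [div_le_one hr0]
          exact S.toLinearMap.singularValues_antitone (not_lt.1 h)
        nlinarith
    refine (Finset.prod_le_prod (fun j _ => Nat.cast_nonneg _) fun j _ => h1 j).trans (le_of_eq ?_)
    rw [Finset.prod_mul_distrib, Finset.prod_const, Finset.card_univ, Fintype.card_fin,
      Fin.prod_univ_eq_prod_range (fun j => if j < ⌊s⌋₊ then α j / r else 1) N]
    congr 1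
    rw [← Finset.prod_subset (s₁ := Finset.range ⌊s⌋₊) (by simpa using hn.le)
      fun j _ hj => if_neg (by simpa using hj)]
    exact Finset.prod_congr rfl fun j hj => if_pos (Finset.mem_range.1 hj)

theorem exp_neg_wordCocycle (hTi : ∀ a, Function.Injective (T a)) (hp : ∀ a, 0 < p a) {s : ℝ}
    (hs : 0 ≤ s) (u : List (Fin m)) :
    Real.exp (-wordCocycle T p s u) = (u.map p).prod / svf s (wordMap T u) := by
  rw [wordCocycle, neg_sub, Real.exp_sub, Real.exp_log (word_prod_pos hp u),
    Real.exp_log (svf_pos (wordMap_injective hTi u) hs)]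

theorem sum_word_prod (hp : ∀ a, 0 < p a) (hp1 : ∑ a, p a = 1) (k : ℕ) :
    ∑ u : Fin k → Fin m, ((List.ofFn u).map p).prod = 1 := by
  have := isProbabilityMeasure_bernoulliMeasure hp hp1
  have h := integral_comp_curtail hp hp1 (fun _ => 1) k
  simp only [integral_const, probReal_univ, smul_eq_mul, mul_one, measureReal_cyl hp hp1] at h
  exact h.symm

/-- The mass of the ball at `point T w i` of the size of a singular value of `T_{i|k}`. -/
theorem ae_eventually_le_measureReal_closedBall (ha0 : 0 ≤ a) (ha1 : a < 1) (ha : ∀ c, ‖T c‖ ≤ a)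
    (hTi : ∀ a, Function.Injective (T a)) (hp : ∀ a, 0 < p a) (hp1 : ∑ a, p a = 1) (hR0 : 0 ≤ R)
    (hR : ∀ u c, ‖w (u ++ [c])‖ ≤ R) {s : ℝ} (hs : 0 ≤ s) (hsN : s < N) {θ : ℝ} (hθ0 : 0 ≤ θ)
    (hθ1 : θ < 1) :
    ∀ᵐ i ∂(bernoulliMeasure p), ∀ᶠ k : ℕ in atTop,
      θ ^ k * Real.exp (-wordCocycle T p s (curtail i k)) *
          (wordMap T (curtail i k)).toLinearMap.singularValues ⌊s⌋₊ ^ s ≤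
        (2 * ((1 - a)⁻¹ * R) + 3) ^ N * (projMeasure T (bernoulliMeasure p) w).real
          (Metric.closedBall (point T w i)
            (√N * (wordMap T (curtail i k)).toLinearMap.singularValues ⌊s⌋₊)) := by
  have := isProbabilityMeasure_bernoulliMeasure hp hp1
  have hD : 0 ≤ (1 - a)⁻¹ * R := mul_nonneg (inv_nonneg.2 (sub_nonneg.2 ha1.le)) hR0
  set D := (1 - a)⁻¹ * R
  have hm := measurable_point ha0 ha1 ha hR
  choose c J hcJ hJne hcdist hJcard using fun u : List (Fin m) =>
    exists_cells (wordMap T u) (wordMap_injective hTi u) hs hsN hD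
  let cell (i : ℕ → Fin m) (u : List (Fin m)) : Fin N → ℤ := c u (point T w i - prefixPoint T w u)
  let f (k : ℕ) (i : ℕ → Fin m) : (_ : List (Fin m)) × (Fin N → ℤ) :=
    ⟨curtail i k, cell i (curtail i k)⟩
  let G (k : ℕ) : Finset ((_ : List (Fin m)) × (Fin N → ℤ)) :=
    (Finset.univ.map ⟨fun u : Fin k → Fin m => List.ofFn u, List.ofFn_injective⟩).sigma J
  have hfG : ∀ k i, f k i ∈ G k := fun k i => by
    simp only [f, G, cell, Finset.mem_sigma, Finset.mem_map, Finset.mem_univ, true_and,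
      Function.Embedding.coeFn_mk]
    refine ⟨⟨fun j => i j, rfl⟩, ?_⟩
    obtain ⟨y, hy, h⟩ := exists_point_eq ha0 ha1 ha hR i k
    rw [h, add_sub_cancel_left]
    exact hcJ _ y hy
  -- The threshold is θ^k times the average mass of a cell of C_u. Summed over all cells and all
  -- words of length k it gives θ^k, which is summable.
  let q (k : ℕ) (x : (_ : List (Fin m)) × (Fin N → ℤ)) : ℝ :=
    θ ^ k * (x.1.map p).prod / (J x.1).card
  have hq0 : ∀ k x, 0 ≤ q k x := fun k x =>
    div_nonneg (mul_nonneg (pow_nonneg hθ0 k) (word_prod_pos hp _).le) (Nat.cast_nonneg _)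
  have hqsum : ∀ k, ∑ x ∈ G k, q k x = θ ^ k := by
    intro k
    simp only [G, q]
    rw [Finset.sum_sigma, Finset.sum_map]
    simp only [Function.Embedding.coeFn_mk, Finset.sum_const, nsmul_eq_mul]
    have : ∀ u : Fin k → Fin m, ((J (List.ofFn u)).card : ℝ) *
        (θ ^ k * ((List.ofFn u).map p).prod / (J (List.ofFn u)).card) =
        θ ^ k * ((List.ofFn u).map p).prod := fun u =>
      mul_div_cancel₀ _ (Nat.cast_ne_zero.2 (hJne _).card_pos.ne')
    simp only [this]
    rw [← Finset.mul_sum, sum_word_prod hp hp1, mul_one]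
  have hae := ae_eventually_le_measureReal_fiber (μ := bernoulliMeasure p) f G hfG q hq0 (by
    simp only [hqsum]
    exact summable_geometric_of_lt_one hθ0 hθ1)
  filter_upwards [hae] with i hi
  filter_upwards [hi] with k hk
  set u := curtail i k
  have hinj := wordMap_injective hTi u
  have hn : ⌊s⌋₊ < N := (Nat.floor_lt hs).2 hsN
  set r := (wordMap T u).toLinearMap.singularValues ⌊s⌋₊
  have hr0 : 0 < r := singularValues_pos_of_injective hinj hn
  have hfib : (bernoulliMeasure p).real {j | f k j = f k i} ≤
      (projMeasure T (bernoulliMeasure p) w).real (Metric.closedBall (point T w i) (√N * r)) := by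
    rw [projMeasure, map_measureReal_apply hm Metric.isClosed_closedBall.measurableSet]
    refine measureReal_mono fun j hj => ?_
    have hj1 : curtail j k = u := congrArg Sigma.fst hj
    have hj2 : cell j (curtail j k) = cell i u := eq_of_heq (Sigma.mk.inj hj).2
    rw [hj1] at hj2
    have := hcdist u _ _ hj2
    rwa [sub_sub_sub_cancel_right, ← dist_eq_norm] at this
  have hJpos : (0 : ℝ) < (J u).card := Nat.cast_pos.2 (hJne u).card_pos
  have h1 : θ ^ k * (u.map p).prod ≤ (J u).card *
      (projMeasure T (bernoulliMeasure p) w).real (Metric.closedBall (point T w i) (√N * r)) := by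
    have h2 : θ ^ k * (u.map p).prod / (J u).card ≤ _ := hk.trans hfib
    rwa [div_le_iff₀' hJpos] at h2
  have hphi := svf_pos hinj hs
  rw [exp_neg_wordCocycle hTi hp hs, ← mul_div_assoc, div_mul_eq_mul_div, div_le_iff₀ hphi]
  calc θ ^ k * (u.map p).prod * r ^ s
      ≤ (J u).card * (projMeasure T (bernoulliMeasure p) w).real
        (Metric.closedBall (point T w i) (√N * r)) * r ^ s := by gcongr
    _ = (J u).card * r ^ s * (projMeasure T (bernoulliMeasure p) w).real
        (Metric.closedBall (point T w i) (√N * r)) := by ring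
    _ ≤ (2 * D + 3) ^ N * svf s (wordMap T u) * (projMeasure T (bernoulliMeasure p) w).real
        (Metric.closedBall (point T w i) (√N * r)) := by
      have := hJcard u
      gcongr
    _ = _ := by ring

/-- If the pressure at `s` is positive, then the upper local dimensions of the projected measure
are almost everywhere at most `s`. -/
theorem ae_eventually_rpow_le_of_pressure_pos (hN : 1 ≤ N) (hTc : ∀ a, ‖T a‖ < 1)
    (hTi : ∀ a, Function.Injective (T a)) (hp : ∀ a, 0 < p a) (hp1 : ∑ a, p a = 1) (hR0 : 0 ≤ R)
    (hR : ∀ u c, ‖w (u ++ [c])‖ ≤ R) {s L : ℝ} (hs : 0 ≤ s) (hsN : s < N)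
    (hL : HasPressureOne T (bernoulliMeasure p) s L) (hL0 : 0 < L) :
    ∀ᵐ i ∂(bernoulliMeasure p), ∀ᶠ r in 𝓝[>] (0 : ℝ),
      r ^ s ≤ (projMeasure T (bernoulliMeasure p) w).real (Metric.closedBall (point T w i) r) := by
  have := isProbabilityMeasure_bernoulliMeasure hp hp1
  obtain ⟨a, ha0, ha1, ha⟩ := exists_norm_le_of_contractions hTc
  obtain ⟨b, hb0, hb⟩ := exists_le_norm_of_injective hTi
  have hm := measurable_point ha0.le ha1 ha hR
  have : IsProbabilityMeasure (projMeasure T (bernoulliMeasure p) w) :=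
    Measure.isProbabilityMeasure_map hm.aemeasurable
  have hn : ⌊s⌋₊ < N := (Nat.floor_lt hs).2 hsN
  have hK : (0 : ℝ) < √N := Real.sqrt_pos.2 (by exact_mod_cast hN)
  set C := (2 * ((1 - a)⁻¹ * R) + 3) ^ N
  have hC0 : 0 < C := by
    have : 0 ≤ (1 - a)⁻¹ * R := mul_nonneg (inv_nonneg.2 (sub_nonneg.2 ha1.le)) hR0
    positivity
  -- The cocycle is eventually below -(L/2)k, and θ = e^{-L/4} spends half of that gain; the
  -- remaining e^{Lk/4} outgrows all constants.
  filter_upwards [ae_eventually_le_measureReal_closedBall ha0.le ha1 ha hTi hp hp1 hR0 hR hs hsN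
      (Real.exp_nonneg (-(L / 4))) (Real.exp_lt_one_iff.2 (by linarith)),
    ae_eventually_wordCocycle_lt hN hTc hTi hp hp1 hs hL (c := -(L / 2)) (by linarith)]
    with i hi1 hi2
  have hr0 : ∀ k, 0 < (wordMap T (curtail i k)).toLinearMap.singularValues ⌊s⌋₊ := fun k =>
    singularValues_pos_of_injective (wordMap_injective hTi _) hn
  -- The scales tend to 0, and appending a letter multiplies the singular value by at least b, so
  -- the ratios of successive scales are bounded below.
  refine eventually_rpow_le_of_scales (monotone_measureReal_closedBall _ _)
    (ρ := fun k => √N * (wordMap T (curtail i k)).toLinearMap.singularValues ⌊s⌋₊)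
    (fun k => mul_pos hK (hr0 k)) ?_ hb0 (fun k => ?_) hs ?_
  · have h1 : Tendsto (fun k : ℕ => √N * a ^ k) atTop (𝓝 (√N * 0)) :=
      (tendsto_pow_atTop_nhds_zero_of_lt_one ha0.le ha1).const_mul _
    rw [mul_zero] at h1
    refine squeeze_zero (fun k => (mul_pos hK (hr0 k)).le) (fun k => ?_) h1
    refine mul_le_mul_of_nonneg_left ?_ hK.le
    refine LinearMap.singularValues_le_of_norm_le _ (by positivity) (fun x => ?_) _
    have := norm_wordMap_apply_le ha0.le ha (curtail i k) x
    rwa [curtail_length] at this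
  · rw [mul_left_comm]
    refine mul_le_mul_of_nonneg_left ?_ hK.le
    rw [curtail_succ, wordMap_append, wordMap_singleton]
    exact LinearMap.mul_singularValues_le_comp _ _ hb0 (hb (i k)) _
  · have hexp : Tendsto (fun k : ℕ => Real.exp (L / 4 * k)) atTop atTop :=
      Real.tendsto_exp_atTop.comp (tendsto_natCast_atTop_atTop.const_mul_atTop (by linarith))
    filter_upwards [hi1, hi2, hexp.eventually_ge_atTop (C * (b⁻¹ ^ s * √N ^ s))] with k h1 h2 h3
    have hrs := Real.rpow_nonneg (hr0 k).le s
    have h4 : Real.exp (L / 4 * k) ≤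
        Real.exp (-(L / 4)) ^ k * Real.exp (-wordCocycle T p s (curtail i k)) := by
      rw [← Real.exp_nat_mul, ← Real.exp_add]
      exact Real.exp_le_exp.2 (by linarith)
    have h5 := (mul_le_mul_of_nonneg_right (h3.trans h4) hrs).trans h1
    rw [Real.mul_rpow hK.le (hr0 k).le]
    refine le_of_mul_le_mul_left (le_trans (le_of_eq ?_) h5) hC0
    ring

end UpperBound

end AlmostSelfAffine

namespace AlmostSelfAffine

/-! ### Lower bound for the local dimension by potentials -/

section LowerBound

variable {m N : ℕ} {T : Fin m → EuclideanSpace ℝ (Fin N) →L[ℝ] EuclideanSpace ℝ (Fin N)}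
  {p : Fin m → ℝ}

theorem bernoulliMeasure_singleton (hm : 2 ≤ m) (hp : ∀ a, 0 < p a) (hp1 : ∑ a, p a = 1)
    (i : ℕ → Fin m) : bernoulliMeasure p {i} = 0 := by
  have : Nonempty (Fin m) := ⟨⟨0, by omega⟩⟩
  obtain ⟨c, -, hc⟩ := Finset.exists_max_image Finset.univ p Finset.univ_nonempty
  have hprod : ∀ u : List (Fin m), (u.map p).prod ≤ p c ^ u.length := by
    intro u
    induction u with
    | nil => simp
    | cons a u ih =>
      rw [List.map_cons, List.prod_cons, List.length_cons, pow_succ']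
      exact mul_le_mul (hc a (Finset.mem_univ a)) ih (word_prod_pos hp u).le (hp c).le
  have hle : ∀ k, bernoulliMeasure p {i} ≤ ENNReal.ofReal (p c ^ k) := fun k => by
    have h1 : {i} ⊆ cyl (curtail i k) :=
      Set.singleton_subset_iff.2 (measure_eq_of_curtail_eq i k)
    refine (measure_mono h1).trans ?_
    rw [bernoulliMeasure_cyl p hp hp1]
    have := hprod (curtail i k)
    rw [curtail_length] at this
    exact ENNReal.ofReal_le_ofReal this
  have hlim : Tendsto (fun k => ENNReal.ofReal (p c ^ k)) atTop (𝓝 (ENNReal.ofReal 0)) :=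
    ENNReal.tendsto_ofReal
      (tendsto_pow_atTop_nhds_zero_of_lt_one (hp c).le (lt_one_of_two_le hm hp hp1 c))
  rw [ENNReal.ofReal_zero] at hlim
  exact le_antisymm (ge_of_tendsto' hlim hle) zero_le

theorem mem_cyl_meet {i j : ℕ → Fin m} : j ∈ cyl (meet i j) := by
  have h : curtail j (PiNat.firstDiff i j) = curtail i (PiNat.firstDiff i j) := by
    unfold curtail
    congr 1
    funext k
    exact (PiNat.apply_eq_of_lt_firstDiff k.2).symm
  simp [cyl, meet, curtail_length, h]

/-- The point i itself is null, and every other j lies in the cylinder of i∧j, which is one of the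
cylinders along i. Enlarging {j : |i∧j| = k} to the whole cylinder is harmless. -/
theorem lintegral_le_tsum_cyl (hm : 2 ≤ m) (hp : ∀ a, 0 < p a) (hp1 : ∑ a, p a = 1)
    {i : ℕ → Fin m} {g : (ℕ → Fin m) → ℝ≥0∞} {h : List (Fin m) → ℝ≥0∞}
    (hg : ∀ j, i ≠ j → g j ≤ h (meet i j)) :
    ∫⁻ j, g j ∂(bernoulliMeasure p) ≤
      ∑' k, h (curtail i k) * bernoulliMeasure p (cyl (curtail i k)) := by
  have hne : ∀ᵐ j ∂(bernoulliMeasure p), i ≠ j := by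
    have := measure_eq_zero_iff_ae_notMem.1 (bernoulliMeasure_singleton hm hp hp1 i)
    filter_upwards [this] with j hj using fun h => hj h.symm
  calc ∫⁻ j, g j ∂(bernoulliMeasure p)
      ≤ ∫⁻ j, ∑' k, (cyl (curtail i k)).indicator (fun _ => h (curtail i k)) j
          ∂(bernoulliMeasure p) := by
        refine lintegral_mono_ae ?_
        filter_upwards [hne] with j hj
        refine (hg j hj).trans ?_
        refine le_trans (le_of_eq ?_) (ENNReal.le_tsum (PiNat.firstDiff i j))
        exact (Set.indicator_of_mem (mem_cyl_meet (i := i)) (fun _ => h (meet i j))).symm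
    _ = _ := by
        rw [lintegral_tsum fun k =>
          ((measurable_const : Measurable fun _ => h (curtail i k)).indicator
            (measurableSet_cyl (curtail i k))).aemeasurable]
        exact tsum_congr fun k => lintegral_indicator_const (measurableSet_cyl _) _

/-- For negative pressure the cocycle eventually exceeds -(L/2)k, so the k-th term is eventually at
most a constant times e^{Lk/2}. -/
theorem ae_tsum_cyl_ne_top (hN : 1 ≤ N) (hTc : ∀ a, ‖T a‖ < 1)
    (hTi : ∀ a, Function.Injective (T a)) (hp : ∀ a, 0 < p a) (hp1 : ∑ a, p a = 1) {s L : ℝ}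
    (hs : 0 ≤ s) (hL : HasPressureOne T (bernoulliMeasure p) s L) (hL0 : L < 0) (c : ℝ) :
    ∀ᵐ i ∂(bernoulliMeasure p), ∑' k, ENNReal.ofReal (c / svf s (wordMap T (curtail i k))) *
      bernoulliMeasure p (cyl (curtail i k)) ≠ ∞ := by
  filter_upwards [ae_eventually_lt_wordCocycle hN hTc hTi hp hp1 hs hL (c := -(L / 2))
    (by linarith)] with i hi
  have hterm : ∀ k, ENNReal.ofReal (c / svf s (wordMap T (curtail i k))) *
      bernoulliMeasure p (cyl (curtail i k)) =
        ENNReal.ofReal (c * Real.exp (-wordCocycle T p s (curtail i k))) := fun k => by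
    rw [bernoulliMeasure_cyl p hp hp1, ← ENNReal.ofReal_mul' (word_prod_pos hp _).le,
      exp_neg_wordCocycle hTi hp hs]
    congr 1
    ring
  simp only [hterm]
  have hsum : Summable fun k => Real.exp (-wordCocycle T p s (curtail i k)) := by
    have hgeo : Summable fun k : ℕ => Real.exp (L / 2) ^ k :=
      summable_geometric_of_lt_one (Real.exp_nonneg _) (Real.exp_lt_one_iff.2 (by linarith))
    refine hgeo.of_norm_bounded_eventually_nat ?_
    filter_upwards [hi] with k hk
    rw [Real.norm_eq_abs, Real.abs_exp, ← Real.exp_nat_mul]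
    exact Real.exp_le_exp.2 (by linarith)
  exact (hsum.mul_left c).tsum_ofReal_ne_top

/-- Tonelli for fixed i, then an exchange of the two "almost every" quantifiers. Only finiteness for
almost every i enters; the double integral over i and j may be infinite. -/
theorem ae_ae_lintegral_lt_top {Ω X : Type*} [MeasurableSpace Ω] [MeasurableSpace X]
    {P : Measure Ω} {μ : Measure X} [SFinite P] [SFinite μ] {f : Ω → X → X → ℝ≥0∞}
    (hf : Measurable fun q : (Ω × X) × X => f q.1.1 q.1.2 q.2)
    (h : ∀ᵐ i ∂μ, ∫⁻ j, ∫⁻ ω, f ω i j ∂P ∂μ ≠ ∞) :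
    ∀ᵐ ω ∂P, ∀ᵐ i ∂μ, ∫⁻ j, f ω i j ∂μ < ∞ := by
  have hF : Measurable fun q : Ω × X => ∫⁻ j, f q.1 q.2 j ∂μ := hf.lintegral_prod_right'
  rw [Measure.ae_ae_comm (p := fun ω i => ∫⁻ j, f ω i j ∂μ < ∞)
    (measurableSet_lt hF measurable_const)]
  filter_upwards [h] with i hi
  have hFi : Measurable fun ω => ∫⁻ j, f ω i j ∂μ :=
    hF.comp (measurable_prodMk_right : Measurable fun ω : Ω => (ω, i))
  refine ae_lt_top hFi ?_
  have hswap : Measurable fun q : Ω × X => f q.1 i q.2 :=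
    hf.comp ((measurable_fst.prodMk measurable_const).prodMk measurable_snd)
  rwa [lintegral_lintegral_swap hswap.aemeasurable]

/-- Finiteness of the energy integrals of the projected measures. -/
theorem ae_ae_energy_lt_top (hm : 2 ≤ m) (hN : 1 ≤ N) (hTc : ∀ a, ‖T a‖ < 1)
    (hTi : ∀ a, Function.Injective (T a)) (hp : ∀ a, 0 < p a) (hp1 : ∑ a, p a = 1)
    {Ω : Type*} [MeasurableSpace Ω] {P : Measure Ω} [IsProbabilityMeasure P]
    {w : Ω → List (Fin m) → EuclideanSpace ℝ (Fin N)} (hw : ∀ u, Measurable fun ω => w ω u)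
    {R : ℝ} (hR : ∀ ω u c, ‖w ω (u ++ [c])‖ ≤ R) {s L c : ℝ} (hs : 0 ≤ s)
    (hL : HasPressureOne T (bernoulliMeasure p) s L) (hL0 : L < 0)
    (hc : ∀ i j : ℕ → Fin m, i ≠ j →
      ∫⁻ ω, ‖point T (w ω) i - point T (w ω) j‖ₑ ^ (-s) ∂P ≤
        ENNReal.ofReal (c / svf s (wordMap T (meet i j)))) :
    ∀ᵐ ω ∂P, ∀ᵐ x ∂(projMeasure T (bernoulliMeasure p) (w ω)),
      ∫⁻ y, ‖x - y‖ₑ ^ (-s) ∂(projMeasure T (bernoulliMeasure p) (w ω)) < ∞ := by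
  have := isProbabilityMeasure_bernoulliMeasure hp hp1
  obtain ⟨a, ha0, ha1, ha⟩ := exists_norm_le_of_contractions hTc
  have hpt := measurable_point_prod hw ha0.le ha1 ha hR
  have hptω : ∀ ω, Measurable (point T (w ω)) := fun ω => measurable_point ha0.le ha1 ha (hR ω)
  have hker : Measurable fun z : EuclideanSpace ℝ (Fin N) => ‖z‖ₑ ^ (-s) :=
    measurable_enorm.pow_const _
  have hint : Measurable fun q : (Ω × (ℕ → Fin m)) × (ℕ → Fin m) =>
      ‖point T (w q.1.1) q.1.2 - point T (w q.1.1) q.2‖ₑ ^ (-s) :=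
    hker.comp ((hpt.comp measurable_fst).sub
      (hpt.comp ((measurable_fst.comp measurable_fst).prodMk measurable_snd)))
  have h2 : ∀ᵐ ω ∂P, ∀ᵐ i ∂(bernoulliMeasure p),
      ∫⁻ j, ‖point T (w ω) i - point T (w ω) j‖ₑ ^ (-s) ∂(bernoulliMeasure p) < ∞ := by
    refine ae_ae_lintegral_lt_top
      (f := fun ω i j => ‖point T (w ω) i - point T (w ω) j‖ₑ ^ (-s)) hint ?_
    filter_upwards [ae_tsum_cyl_ne_top hN hTc hTi hp hp1 hs hL hL0 c] with i hi
    exact ne_top_of_le_ne_top hi (lintegral_le_tsum_cyl hm hp hp1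
      (h := fun u => ENNReal.ofReal (c / svf s (wordMap T u))) fun j hj => hc i j hj)
  filter_upwards [h2] with ω hω
  have : IsProbabilityMeasure (projMeasure T (bernoulliMeasure p) (w ω)) :=
    Measure.isProbabilityMeasure_map (hptω ω).aemeasurable
  have hE : Measurable fun x => ∫⁻ y, ‖x - y‖ₑ ^ (-s)
      ∂(projMeasure T (bernoulliMeasure p) (w ω)) :=
    (hker.comp (measurable_fst.sub measurable_snd)).lintegral_prod_right'
  have hset : MeasurableSet {x | ∫⁻ y, ‖x - y‖ₑ ^ (-s)
      ∂(projMeasure T (bernoulliMeasure p) (w ω)) < ∞} := measurableSet_lt hE measurable_const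
  rw [projMeasure] at hset ⊢
  rw [ae_map_iff (hptω ω).aemeasurable hset]
  filter_upwards [hω] with i hi
  have hsub : Measurable fun y => ‖point T (w ω) i - y‖ₑ ^ (-s) :=
    hker.comp (measurable_const.sub measurable_id)
  rwa [lintegral_map hsub (hptω ω)]

/-- Markov's inequality: on the r-ball about x the kernel is at least r^{-s}, so the ball has mass
at most r^s times the potential; r^{s-t} → 0 absorbs that constant. -/
theorem eventually_measureReal_le_of_energy {ν : Measure (EuclideanSpace ℝ (Fin N))}
    [IsProbabilityMeasure ν] {s t : ℝ} (hs : 0 ≤ s) (hts : t < s) {x : EuclideanSpace ℝ (Fin N)}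
    (hx : ∫⁻ y, ‖x - y‖ₑ ^ (-s) ∂ν < ∞) :
    ∀ᶠ r in 𝓝[>] (0 : ℝ), ν.real (Metric.closedBall x r) ≤ r ^ t := by
  set I := ∫⁻ y, ‖x - y‖ₑ ^ (-s) ∂ν
  have hpow : Tendsto (fun r : ℝ => I.toReal * r ^ (s - t)) (𝓝[>] 0) (𝓝 0) := by
    have h1 := (Real.continuousAt_rpow_const 0 (s - t) (Or.inr (sub_pos.2 hts).le)).tendsto
    rw [Real.zero_rpow (sub_pos.2 hts).ne'] at h1
    have h2 := (h1.mono_left (nhdsWithin_le_nhds (s := Set.Ioi 0))).const_mul I.toReal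
    rwa [mul_zero] at h2
  filter_upwards [hpow.eventually (gt_mem_nhds one_pos), self_mem_nhdsWithin] with r hr hr0
  have hr0 : 0 < r := hr0
  have h1 : ENNReal.ofReal (r ^ (-s)) * ν (Metric.closedBall x r) ≤ I := by
    rw [← setLIntegral_const]
    refine (setLIntegral_mono_ae' Metric.isClosed_closedBall.measurableSet
      (ae_of_all _ fun y hy => ?_)).trans (setLIntegral_le_lintegral _ _)
    rw [← ENNReal.ofReal_rpow_of_pos hr0]
    rw [ENNReal.rpow_neg, ENNReal.rpow_neg]
    refine ENNReal.inv_le_inv.2 (ENNReal.rpow_le_rpow ?_ hs)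
    rw [← ofReal_norm, ← dist_eq_norm, dist_comm]
    exact ENNReal.ofReal_le_ofReal hy
  have h2 := ENNReal.toReal_mono hx.ne h1
  rw [ENNReal.toReal_mul, ENNReal.toReal_ofReal (Real.rpow_nonneg hr0.le _),
    Real.rpow_neg hr0.le, inv_mul_le_iff₀ (Real.rpow_pos_of_pos hr0 s)] at h2
  have h3 : r ^ s = r ^ (s - t) * r ^ t := by rw [← Real.rpow_add hr0, sub_add_cancel]
  calc ν.real (Metric.closedBall x r) ≤ r ^ s * I.toReal := h2
    _ = I.toReal * r ^ (s - t) * r ^ t := by rw [h3]; ring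
    _ ≤ 1 * r ^ t := by gcongr
    _ = r ^ t := one_mul _

end LowerBound

theorem exists_norm_translation_le {m N : ℕ}
    {T : Fin m → EuclideanSpace ℝ (Fin N) →L[ℝ] EuclideanSpace ℝ (Fin N)} (hTc : ∀ a, ‖T a‖ < 1)
    {B : Set (EuclideanSpace ℝ (Fin N))} (hBc : IsCompact B) (hBn : B.Nonempty) :
    ∃ R : ℝ, 0 ≤ R ∧ ∀ (a : Fin m) (v : EuclideanSpace ℝ (Fin N)),
      (∀ x ∈ B, T a x + v ∈ B) → ‖v‖ ≤ R := by
  obtain ⟨R, hR⟩ := hBc.isBounded.exists_norm_le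
  obtain ⟨x, hx⟩ := hBn
  have hR0 : 0 ≤ R := (norm_nonneg x).trans (hR x hx)
  refine ⟨R + R, by positivity, fun a v h => ?_⟩
  have h1 := hR _ (h x hx)
  have h2 : ‖T a x‖ ≤ R := by
    refine ((T a).le_opNorm x).trans ?_
    exact (mul_le_of_le_one_left (norm_nonneg x) (hTc a).le).trans (hR x hx)
  calc ‖v‖ = ‖(T a x + v) - T a x‖ := by rw [add_sub_cancel_left]
    _ ≤ _ := (norm_sub_le _ _).trans (add_le_add h1 h2)

end AlmostSelfAffine

/-! ### The main theorem -/

theorem theorem5p2 {m N : ℕ} (hm : 2 ≤ m) (hN : 1 ≤ N)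
    -- non-singular linear contractions
    (T : Fin m → EuclideanSpace ℝ (Fin N) →L[ℝ] EuclideanSpace ℝ (Fin N))
    (hTc : ∀ a, ‖T a‖ < 1) (hTi : ∀ a, Function.Injective (T a))
    -- probabilities
    (p : Fin m → ℝ) (hp : ∀ a, 0 < p a) (hp1 : ∑ a, p a = 1)
    -- random translations
    {Ω : Type*} [MeasurableSpace Ω] (P : Measure Ω) [IsProbabilityMeasure P]
    (w : Ω → List (Fin m) → EuclideanSpace ℝ (Fin N))
    (hw : ∀ u, Measurable (fun ω => w ω u))
    -- a compact set that is mapped into itself at every stage of the construction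
    (B : Set (EuclideanSpace ℝ (Fin N))) (hBc : IsCompact B) (hBn : B.Nonempty)
    (hB : ∀ ω, ∀ (u : List (Fin m)) (a : Fin m), ∀ x ∈ B, T a x + w ω (u ++ [a]) ∈ B) :
    -- the pressure `P(s,1)` has exactly one positive zero `d₁`
    (∃! d₁ : ℝ, 0 < d₁ ∧ HasPressureOne T (bernoulliMeasure p) d₁ 0) ∧
    ∀ d₁ : ℝ, 0 < d₁ → HasPressureOne T (bernoulliMeasure p) d₁ 0 →
      -- the integral estimate, for some `s` arbitrarily close to `min d₁ N` from below
      (∀ t < min d₁ (N : ℝ), ∃ s, t < s ∧ s < min d₁ (N : ℝ) ∧ ∃ c : ℝ,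
        ∀ i j : ℕ → Fin m, i ≠ j →
          ∫⁻ ω, ‖point T (w ω) i - point T (w ω) j‖ₑ ^ (-s) ∂P ≤
            ENNReal.ofReal (c / svf s (wordMap T (meet i j)))) →
      ∀ᵐ ω ∂P,
        IsExactOfDimension (projMeasure T (bernoulliMeasure p) (w ω)) (min d₁ (N : ℝ)) ∧
        HasInfoDim (projMeasure T (bernoulliMeasure p) (w ω)) (min d₁ (N : ℝ)) := by
  refine ⟨existsUnique_hasPressureOne_zero hm hN hTc hTi hp hp1, fun d₁ hd₁ hpr hen => ?_⟩
  have := isProbabilityMeasure_bernoulliMeasure hp hp1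
  obtain ⟨a, ha0, ha1, ha⟩ := exists_norm_le_of_contractions hTc
  obtain ⟨R, hR0, hRB⟩ := exists_norm_translation_le hTc hBc hBn
  have hR : ∀ ω u c, ‖w ω (u ++ [c])‖ ≤ R := fun ω u c => hRB c _ (hB ω u c)
  set d := min d₁ (N : ℝ) with hd
  have hd0 : 0 < d := lt_min hd₁ (by exact_mod_cast hN)
  have hseq : ∀ n : ℕ, max 0 (d - 1 / ((n : ℝ) + 1)) < d := fun n =>
    max_lt hd0 (sub_lt_self _ (by positivity))
  choose s hts hsd c hc using fun n => hen _ (hseq n)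
  have hs0 : ∀ n, 0 ≤ s n := fun n => ((le_max_left _ _).trans_lt (hts n)).le
  have henergy : ∀ᵐ ω ∂P, ∀ n, ∀ᵐ x ∂(projMeasure T (bernoulliMeasure p) (w ω)),
      ∫⁻ y, ‖x - y‖ₑ ^ (-s n) ∂(projMeasure T (bernoulliMeasure p) (w ω)) < ∞ := by
    refine ae_all_iff.2 fun n => ?_
    obtain ⟨L, hL⟩ := exists_hasPressureOne hN hTc hTi hp hp1 (hs0 n)
    exact ae_ae_energy_lt_top hm hN hTc hTi hp hp1 hw hR (hs0 n) hL
      (hasPressureOne_lt hN hTc hTi hp hp1 (hs0 n) ((hsd n).trans_le (min_le_left _ _)) hL hpr)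
      (hc n)
  filter_upwards [henergy] with ω hω
  have hmeas : Measurable (point T (w ω)) := measurable_point ha0.le ha1 ha (hR ω)
  have hprob : IsProbabilityMeasure (projMeasure T (bernoulliMeasure p) (w ω)) :=
    Measure.isProbabilityMeasure_map hmeas.aemeasurable
  have hlow : ∀ t < d, ∀ᵐ x ∂(projMeasure T (bernoulliMeasure p) (w ω)), ∀ᶠ r in 𝓝[>] (0 : ℝ),
      (projMeasure T (bernoulliMeasure p) (w ω)).real (Metric.closedBall x r) ≤ r ^ t := by
    intro t ht
    obtain ⟨n, hn⟩ := exists_nat_one_div_lt (sub_pos.2 ht)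
    filter_upwards [hω n] with x hx
    have : d - 1 / ((n : ℝ) + 1) < s n := (le_max_right _ _).trans_lt (hts n)
    exact eventually_measureReal_le_of_energy (hs0 n) (by linarith) hx
  have hup : ∀ t > d, ∀ᵐ x ∂(projMeasure T (bernoulliMeasure p) (w ω)), ∀ᶠ r in 𝓝[>] (0 : ℝ),
      r ^ t ≤ (projMeasure T (bernoulliMeasure p) (w ω)).real (Metric.closedBall x r) := by
    intro t ht
    -- If d₁ < N, an exponent strictly between d₁ and min t N has positive pressure and is below N,
    -- as the covering by cells demands. Otherwise d = N and the general bound suffices.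
    rcases lt_or_ge d₁ (N : ℝ) with h | h
    · have hdd : d = d₁ := min_eq_left h.le
      obtain ⟨t', ht1, ht2⟩ := exists_between (lt_min (hdd ▸ ht : d₁ < t) h)
      have ht0 : 0 ≤ t' := hd₁.le.trans ht1.le
      obtain ⟨L, hL⟩ := exists_hasPressureOne hN hTc hTi hp hp1 ht0
      exact ae_map_eventually_rpow_le hmeas ht0 (ht2.trans_le (min_le_left _ _))
        (ae_eventually_rpow_le_of_pressure_pos hN hTc hTi hp hp1 hR0 (hR ω) ht0
          (ht2.trans_le (min_le_right _ _)) hL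
          (hasPressureOne_lt hN hTc hTi hp hp1 hd₁.le ht1 hpr hL))
    · have hdd : d = N := min_eq_right h
      exact ae_eventually_rpow_le_of_dim_lt _ (hdd ▸ ht)
  refine ⟨isExactOfDimension_of_bounds hlow hup,
    hasInfoDim_of_bounds hN (R := (1 - a)⁻¹ * R)
      (mul_nonneg (inv_nonneg.2 (sub_nonneg.2 ha1.le)) hR0) ?_ hd0.le hlow hup⟩
  rw [projMeasure, Measure.map_apply hmeas Metric.isClosed_closedBall.measurableSet.compl]
  refine measure_mono_null (fun i hi => hi ?_) measure_empty
  exact mem_closedBall_zero_iff.2 (norm_point_le ha0.le ha1 ha (hR ω) i)
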